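/- Let $C>0$, $\gamma>1$, $\tilde C:=\max\{C,1\}$. Let $\mathcal Z$ be a countably infinite data space, $\mathcal H_{\rm all}$ a hypothesis set, $\ell:\mathcal H_{\rm all}\times\mathcal Z\to\mathbb R$ a loss, $\mathrm{DI}(\ell):=\sup\ell-\inf\ell\in[0,+\infty]$ (over all $h$ and $z$), and $\mathfrak A:\bigcup_{n\ge0}\mathcal Z^n\to\mathcal H_{\rm all}$ a symmetric algorithm (its output does not change when the data sequence is permuted). Let $Q$ be a probability distribution on $\mathcal Z$ with power-law decay: for some bijection $z:\mathbb N\to\mathcal Z$, $q_j:=Q(z(j))\le C(j+1)^{-\gamma}$ for all $j\in\mathbb N=\{0,1,2,\dots\}$. For $\mathbf z\in\mathcal Z^n$ put $\mathrm{GenGap}_{\mathbf z}(h):=\mathbb E_{Z\sim Q}\,\ell(h,Z)-\frac1n\sum_{i=1}^n\ell(h,z_i)$. Put $\kappa^*(n):=\min_{\alpha\in[0,1]}n^\alpha\exp((1-\alpha)H_\alpha(Q))$ with $H_\alpha$ the Rényi entropy, and $$k(n):=\frac{e\tilde C}{\gamma-1}\,n^{1/\gamma}(\ln n+\gamma).$$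 Below, $\mathbf Z\sim Q^n$. (1) For all $n\ge1$, $\kappa^*(n)\le k(n)$. (2) For all $n\ge1$ and $\delta_1,\delta_2,\delta_3>0$, with probability at least $1-(\delta_1+\delta_2+\delta_3)$, $$\mathrm{GenGap}_{\mathbf Z}(\mathfrak A(\mathbf Z))\le\mathrm{DI}(\ell)\sqrt{\frac{\bigl(k(n)+\sqrt{\tfrac n2\ln\tfrac2{\delta_3}}\bigr)\bigl(3\ln n+\ln(2\pi)+\ln\tfrac1{\delta_2}\bigr)+\ln\tfrac1{\delta_1}}{2n}}.$$ (3) Let $\mathrm{DI}(\ell)>0$, $\delta,\varepsilon\in(0,1]$, $\delta_2:=\delta/3$, $[x]_+:=\max\{x,0\}$, $$\omega(\delta,\varepsilon):=\max\Bigl\{\tfrac{324\ln\frac3\delta}{\varepsilon^4}\Bigl(\ln\tfrac{9\sqrt{2\ln\frac3\delta}}{\varepsilon^2}\Bigr)^2,\ \tfrac3{2\varepsilon^2}\ln\tfrac3\delta\Bigr\},\quad B_1:=\tfrac{9e\tilde C}{\varepsilon^2(\gamma-1)},\quad B_2:=\tfrac{6e\tilde C}{2\varepsilon^2}\Bigl(\tfrac{3\gamma}{\gamma-1}+\tfrac1{\gamma-1}\ln\tfrac{2\pi}{\delta_2}\Bigr).$$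 If $n>\omega(\delta,\varepsilon)$ and $$n>\max\Bigl\{B_1^{\frac\gamma{\gamma-1}}\Bigl(\tfrac{4\gamma}{\gamma-1}\bigl[\ln\tfrac{2\gamma}{\gamma-1}+\tfrac12\ln B_1\bigr]_+\Bigr)^{\frac{2\gamma}{\gamma-1}},\ B_2^{\frac\gamma{\gamma-1}}\Bigl(\tfrac{2\gamma}{\gamma-1}\bigl[\ln\tfrac\gamma{\gamma-1}+\ln B_2\bigr]_+\Bigr)^{\frac\gamma{\gamma-1}},\ \Bigl(\tfrac{6e\tilde C\gamma}{\varepsilon^2(\gamma-1)}\ln\tfrac{2\pi}{\delta_2}\Bigr)^{\frac\gamma{\gamma-1}}\Bigr\},$$ then with probability at least $1-\delta$, $\mathrm{GenGap}_{\mathbf Z}(\mathfrak A(\mathbf Z))<\mathrm{DI}(\ell)\,\varepsilon$. (4) For every $\delta\in(0,1)$ there is a constant $K>0$ depending only on $C,\gamma,\delta$ such that, for all $\mathcal Z,\mathcal H_{\rm all},\ell,\mathfrak A,Q$ as above: for all $n\ge2$, with probability at least $1-\delta$, $\mathrm{GenGap}_{\mathbf Z}(\mathfrak A(\mathbf Z))\le\mathrm{DI}(\ell)\,K\sqrt{(\ln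 n)^2/n^{(\gamma-1)/\gamma}}$; and if $\mathrm{DI}(\ell)>0$, $\varepsilon\in(0,\frac12]$ and $n\ge K\bigl(\varepsilon^{-2}(\ln\frac1\varepsilon)^2\bigr)^{\gamma/(\gamma-1)}$, then with probability at least $1-\delta$, $\mathrm{GenGap}_{\mathbf Z}(\mathfrak A(\mathbf Z))<\mathrm{DI}(\ell)\,\varepsilon$. -/

import Mathlib

open MeasureTheory
open scoped ENNReal

noncomputable section

namespace GenGap

/-- Expected risk `E_{Z ~ Q} ℓ(h, Z)`. -/
def risk {Z H : Type*} [MeasurableSpace Z] (ℓ : H → Z → ℝ) (Q : Measure Z) (h : H) : ℝ :=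
  ∫ z, ℓ h z ∂Q

/-- Empirical risk `(1/n) ∑ ℓ(h, z_i)` on a data sequence of length `n`. -/
def empRisk {Z H : Type*} (ℓ : H → Z → ℝ) {n : ℕ} (zs : Fin n → Z) (h : H) : ℝ :=
  (1 / (n : ℝ)) * ∑ i, ℓ h (zs i)

/-- Generalization gap: expected risk minus empirical risk. -/
def genGap {Z H : Type*} [MeasurableSpace Z] (ℓ : H → Z → ℝ) (Q : Measure Z) {n : ℕ}
    (zs : Fin n → Z) (h : H) : ℝ :=
  risk ℓ Q h - empRisk ℓ zs h

/-- Diameter of the image of the loss, `sup ℓ - inf ℓ ∈ [0, ∞]`. -/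
def lossDiam {Z H : Type*} (ℓ : H → Z → ℝ) : EReal :=
  (⨆ h, ⨆ z, (ℓ h z : EReal)) - ⨅ h, ⨅ z, (ℓ h z : EReal)

/-- A learning algorithm, as a map on finite data sequences, is symmetric if its output does not
change when the data sequence is permuted. -/
def IsSymmetricAlg {Z H : Type*} (A : List Z → H) : Prop :=
  ∀ (n : ℕ) (σ : Equiv.Perm (Fin n)) (zs : Fin n → Z),
    A (List.ofFn zs) = A (List.ofFn fun i => zs (σ i))

/-- Rényi entropy of order `α ∈ [0, ∞]` of a discrete distribution, with values in `[0, ∞]`. -/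
def renyiEntropy {Z : Type*} [MeasurableSpace Z] (Q : Measure Z) (α : ℝ≥0∞) : EReal :=
  if α = 1 then ((∑' z, ENNReal.ofReal (Real.negMulLog (Q.real {z})) : ℝ≥0∞) : EReal)
  else if α = 0 then ENNReal.log (({z : Z | 0 < Q {z}}.encard : ℕ∞) : ℝ≥0∞)
  else if α = ∞ then - ENNReal.log (⨆ z, Q {z})
  else ((1 / (1 - α.toReal) : ℝ) : EReal) * ENNReal.log (∑' z, Q {z} ^ α.toReal)

/-- `κ_{(Q,α)}(n) = n^α exp((1 - α) H_α(Q))`. -/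
def kappa {Z : Type*} [MeasurableSpace Z] (Q : Measure Z) (α : ℝ) (n : ℕ) : ℝ≥0∞ :=
  (n : ℝ≥0∞) ^ α * EReal.exp (((1 - α : ℝ) : EReal) * renyiEntropy Q (ENNReal.ofReal α))

/-- `κ*_{(Q)}(n)`, the minimum of `κ_{(Q,α)}(n)` over `α ∈ [0, 1]`. -/
def kappaStar {Z : Type*} [MeasurableSpace Z] (Q : Measure Z) (n : ℕ) : ℝ≥0∞ :=
  ⨅ α ∈ Set.Icc (0 : ℝ) 1, kappa Q α n

/-- `Q` decays according to a power law with constant `C` and exponent `γ`: for some numbering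
`z` of the (countably infinite) data space, `Q(z(j)) ≤ C (j + 1)^{-γ}` for all `j`. -/
def PowerLawDecay {Z : Type*} [MeasurableSpace Z] (Q : Measure Z) (C γ : ℝ) : Prop :=
  ∃ z : ℕ ≃ Z, ∀ j : ℕ, Q.real {z j} ≤ C * ((j : ℝ) + 1) ^ (-γ)

/-- The explicit bound `(e C̃ / (γ - 1)) n^{1/γ} (ln n + γ)` on `κ*(n)`, with `C̃ = max C 1`. -/
def powerLawKappaBound (C γ : ℝ) (n : ℕ) : ℝ :=
  Real.exp 1 * max C 1 / (γ - 1) * (n : ℝ) ^ (1 / γ) * (Real.log n + γ)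

/-- The function `ω(δ, ε)`. -/
def omega (δ ε : ℝ) : ℝ :=
  max
    (324 * Real.log (3 / δ) / ε ^ 4 *
      (Real.log (9 * √(2 * Real.log (3 / δ)) / ε ^ 2)) ^ 2)
    (3 / (2 * ε ^ 2) * Real.log (3 / δ))

/-- First term of the sufficient data length for power-law decay. -/
def powerLawLength₁ (C γ ε : ℝ) : ℝ :=
  (9 * Real.exp 1 * max C 1 / (ε ^ 2 * (γ - 1))) ^ (γ / (γ - 1)) *
    (4 * γ / (γ - 1) *
      max (Real.log (2 * γ / (γ - 1))
        + 1 / 2 * Real.log (9 * Real.exp 1 * max C 1 / (ε ^ 2 * (γ - 1)))) 0)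
      ^ (2 * γ / (γ - 1))

/-- The base `(6 e C̃ / (2 ε²)) (3γ/(γ-1) + (1/(γ-1)) ln(2π/δ₂))` of the second term. -/
def powerLawBase₂ (C γ δ₂ ε : ℝ) : ℝ :=
  6 * Real.exp 1 * max C 1 / (2 * ε ^ 2) *
    (3 * γ / (γ - 1) + 1 / (γ - 1) * Real.log (2 * Real.pi / δ₂))

/-- Second term of the sufficient data length for power-law decay. -/
def powerLawLength₂ (C γ δ₂ ε : ℝ) : ℝ :=
  powerLawBase₂ C γ δ₂ ε ^ (γ / (γ - 1)) *
    (2 * γ / (γ - 1) *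
      max (Real.log (γ / (γ - 1)) + Real.log (powerLawBase₂ C γ δ₂ ε)) 0) ^ (γ / (γ - 1))

/-- Third term of the sufficient data length for power-law decay. -/
def powerLawLength₃ (C γ δ₂ ε : ℝ) : ℝ :=
  (6 * Real.exp 1 * max C 1 * γ / (ε ^ 2 * (γ - 1)) * Real.log (2 * Real.pi / δ₂))
    ^ (γ / (γ - 1))

/-- The explicit data length for power-law decay, with the failure probability `δ₂ = δ / 3`. -/
def powerLawLength (C γ δ ε : ℝ) : ℝ :=
  max (powerLawLength₁ C γ ε) (max (powerLawLength₂ C γ (δ / 3) ε) (powerLawLength₃ C γ (δ / 3) ε))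

end GenGap

end

/-! Hoeffding's inequality holds for one fixed hypothesis, so the point is to show that, off an
event of small probability, the algorithm has few possible outputs. Rank the data by the power law
and cut at `b = ⌈n^(1/γ)⌉`. By symmetry the output is determined by the frequencies of the ranks
below `b`, for which there are at most `(n+1)^b` choices, and by the word that records which rare
letter stands where.

Rare words are counted by a weight. A letter of rank `j ≥ b` has weight `1 + β ln((j+1)/b)` with `β
= (γ-1)/2`, and a frequent letter has weight `0`. The power law gives the exponential of this weight
mean at most `1 + x`, where `x` is of order `b^(1-γ)`, so the total weight exceeds `nx + L` with
probability at most `e^(-L)` (`measure_sum_gt_le_exp`, `lintegral_exp_rankWeight_le`). Words of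
small total weight have large Kraft weight, hence are few (`finite_and_ncard_words_le`,
`exp_neg_le_kraftWeight`).

A union bound over the outputs (`le_measure_genGap_le_of_mem_Icc`) turns the logarithm of their
number, here called the code length, into a bound on the gap. The chosen `b` makes `b` and `nx` both
of order `n^(1/γ)`. Parts (2)-(4) then only compare this code length with `2nt²`; there `k(n)` is
just a formula to be dominated.

The entropy bound (1) is independent of this: evaluate `κ` at `α = 1/γ + 1/ln n`, or at `α = 1` when
`n` is small. -/

namespace GenGap

/-! ### Hoeffding, the union bound, and exponential Markov -/

section Concentration

variable {Z H : Type*} [MeasurableSpace Z] [DiscreteMeasurableSpace Z]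

/-- Hoeffding's inequality for the generalization gap of a fixed hypothesis. -/
theorem measure_genGap_gt_le (ℓ : H → Z → ℝ) (Q : Measure Z) [IsProbabilityMeasure Q]
    {n : ℕ} (hn : 0 < n) {a b t : ℝ} (ht : 0 ≤ t) (h : H) (hab : ∀ z, ℓ h z ∈ Set.Icc a b) :
    (Measure.pi fun _ : Fin n => Q).real {zs | (b - a) * t < genGap ℓ Q zs h} ≤
      Real.exp (-(2 * n * t ^ 2)) := by
  have hn' : (0 : ℝ) < n := by exact_mod_cast hn
  have hZ : Nonempty Z := by
    by_contra hZ
    rw [not_nonempty_iff] at hZ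
    have := measure_univ (μ := Q)
    simp [Set.univ_eq_empty_iff.mpr hZ] at this
  obtain ⟨z₀⟩ := hZ
  have hle : a ≤ b := (hab z₀).1.trans (hab z₀).2
  have hgap : ∀ zs : Fin n → Z, genGap ℓ Q zs h =
      (1 / (n : ℝ)) * ∑ i, (-ℓ h (zs i) - ∫ z, -ℓ h z ∂Q) := by
    intro zs
    simp only [genGap, risk, empRisk, integral_neg, Finset.sum_sub_distrib, Finset.sum_neg_distrib,
      Finset.sum_const, Finset.card_univ, Fintype.card_fin, nsmul_eq_mul]
    field_simp
    ring
  -- For a constant loss the Hoeffding exponent would be `0/0`; the gap is then zero and the event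
  -- is empty.
  rcases hle.eq_or_lt with heq | hlt
  · have hconst : ∀ z, ℓ h z = a := fun z => le_antisymm (heq ▸ (hab z).2) (hab z).1
    have : {zs : Fin n → Z | (b - a) * t < genGap ℓ Q zs h} = ∅ := by
      ext zs
      simp [hgap, hconst, heq]
    rw [this]
    simpa using (Real.exp_pos _).le
  -- The gap is the mean of the centred variables `-ℓ`, so its upper tail is theirs.
  have hsub : ProbabilityTheory.HasSubgaussianMGF (fun z => -ℓ h z - ∫ z, -ℓ h z ∂Q)
      ((‖-a - -b‖₊ / 2) ^ 2) Q :=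
    ProbabilityTheory.hasSubgaussianMGF_of_mem_Icc
      (X := fun z => -ℓ h z) (Measurable.of_discrete).aemeasurable
      (Filter.Eventually.of_forall fun z => ⟨by linarith [(hab z).2], by linarith [(hab z).1]⟩)
  have hind := ProbabilityTheory.iIndepFun_pi (μ := fun _ : Fin n => Q)
    (X := fun _ z => -ℓ h z - ∫ z, -ℓ h z ∂Q) (fun _ => (Measurable.of_discrete).aemeasurable)
  have hsub' : ∀ i ∈ (Finset.univ : Finset (Fin n)), ProbabilityTheory.HasSubgaussianMGF
      (fun zs : Fin n → Z => -ℓ h (zs i) - ∫ z, -ℓ h z ∂Q)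
      ((‖-a - -b‖₊ / 2) ^ 2) (Measure.pi fun _ : Fin n => Q) := by
    intro i _
    have hmp := measurePreserving_eval (fun _ : Fin n => Q) i
    refine ProbabilityTheory.HasSubgaussianMGF.of_map (Y := fun zs : Fin n → Z => zs i)
      (X := fun z => -ℓ h z - ∫ z, -ℓ h z ∂Q) hmp.measurable.aemeasurable ?_
    exact hmp.map_eq.symm ▸ hsub
  have key := ProbabilityTheory.HasSubgaussianMGF.measure_sum_ge_le_of_iIndepFun hind hsub'
    (ε := n * ((b - a) * t)) (by have := sub_pos.mpr hlt; positivity)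
  refine (measureReal_mono ?_).trans (key.trans (le_of_eq ?_))
  · intro zs hzs
    simp only [Set.mem_ofPred_eq, hgap] at hzs ⊢
    rw [one_div, inv_mul_eq_div, lt_div_iff₀ hn'] at hzs
    linarith
  · congr 1
    have h1 : ((‖-a - -b‖₊ : NNReal) : ℝ) = b - a := by
      rw [coe_nnnorm, Real.norm_eq_abs, abs_of_nonneg] <;> linarith
    push_cast
    simp only [Finset.sum_const, Finset.card_univ, Fintype.card_fin, nsmul_eq_mul,
      ← coe_nnnorm, h1]
    have : b - a ≠ 0 := (sub_pos.mpr hlt).ne'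
    field_simp

/-- A union bound over the finitely many outputs which an algorithm has on a set of samples. -/
theorem measure_genGap_gt_le_of_ncard_image (ℓ : H → Z → ℝ) (Q : Measure Z)
    [IsProbabilityMeasure Q] {n : ℕ} (hn : 0 < n) {a b t : ℝ} (ht : 0 ≤ t)
    (hab : ∀ h z, ℓ h z ∈ Set.Icc a b) (F : (Fin n → Z) → H) (G : Set (Fin n → Z))
    (hfin : (F '' G).Finite) :
    (Measure.pi fun _ : Fin n => Q).real {zs | zs ∈ G ∧ (b - a) * t < genGap ℓ Q zs (F zs)} ≤
      (F '' G).ncard * Real.exp (-(2 * n * t ^ 2)) := by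
  have hsub : {zs | zs ∈ G ∧ (b - a) * t < genGap ℓ Q zs (F zs)} ⊆
      ⋃ h ∈ hfin.toFinset, {zs | (b - a) * t < genGap ℓ Q zs h} := by
    rintro zs ⟨hG, hz⟩
    simp only [Set.mem_iUnion]
    exact ⟨F zs, by simpa using ⟨zs, hG, rfl⟩, hz⟩
  refine (measureReal_mono hsub (measure_ne_top _ _)).trans ((measureReal_biUnion_finset_le _ _).trans ?_)
  refine (Finset.sum_le_sum fun h _ => measure_genGap_gt_le ℓ Q hn ht h (hab h)).trans ?_
  rw [Finset.sum_const, nsmul_eq_mul, Set.ncard_eq_toFinset_card _ hfin]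

variable [Countable Z]

/-- The exponential Markov inequality for a sum of independent copies. -/
theorem measure_sum_gt_le_exp (Q : Measure Z) [IsProbabilityMeasure Q] (n : ℕ) (g : Z → ℝ)
    {x L : ℝ}
    (hg : ∫⁻ z, ENNReal.ofReal (Real.exp (g z)) ∂Q ≤ ENNReal.ofReal (1 + x)) :
    (Measure.pi fun _ : Fin n => Q).real {zs | n * x + L < ∑ i, g (zs i)} ≤ Real.exp (-L) := by
  have hind := ProbabilityTheory.iIndepFun_pi (μ := fun _ : Fin n => Q)
    (X := fun _ z => ENNReal.ofReal (Real.exp (g z)))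
    (fun _ => (Measurable.of_discrete).aemeasurable)
  have hprod : ∫⁻ zs : Fin n → Z, ∏ i, ENNReal.ofReal (Real.exp (g (zs i)))
      ∂(Measure.pi fun _ : Fin n => Q) ≤ ENNReal.ofReal (Real.exp (n * x)) := by
    have := ProbabilityTheory.lintegral_prod_eq_prod_lintegral_of_indepFun Finset.univ
      (fun i (zs : Fin n → Z) => ENNReal.ofReal (Real.exp (g (zs i)))) hind
      (fun i => Measurable.of_discrete)
    rw [this]
    have heach : ∀ i : Fin n, ∫⁻ zs : Fin n → Z, ENNReal.ofReal (Real.exp (g (zs i)))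
        ∂(Measure.pi fun _ : Fin n => Q) ≤ ENNReal.ofReal (Real.exp x) := by
      intro i
      have hmp := measurePreserving_eval (fun _ : Fin n => Q) i
      rw [← lintegral_map (f := fun z => ENNReal.ofReal (Real.exp (g z)))
        Measurable.of_discrete hmp.measurable]
      rw [show Measure.map (fun a : Fin n → Z => a i) (Measure.pi fun _ : Fin n => Q) = Q from
        hmp.map_eq]
      exact hg.trans (ENNReal.ofReal_le_ofReal (by linarith [Real.add_one_le_exp x]))
    refine (Finset.prod_le_prod' fun i _ => heach i).trans (le_of_eq ?_)
    rw [Finset.prod_const, Finset.card_univ, Fintype.card_fin,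
      ← ENNReal.ofReal_pow (Real.exp_pos _).le, ← Real.exp_nat_mul]
  have hmark := meas_ge_le_lintegral_div (μ := Measure.pi fun _ : Fin n => Q)
    (f := fun zs : Fin n → Z => ∏ i, ENNReal.ofReal (Real.exp (g (zs i))))
    (Measurable.of_discrete).aemeasurable (ε := ENNReal.ofReal (Real.exp (n * x + L)))
    (by simpa using Real.exp_pos _) ENNReal.ofReal_ne_top
  rw [measureReal_def]
  refine ENNReal.toReal_le_of_le_ofReal (Real.exp_pos _).le ?_
  refine (measure_mono ?_).trans (hmark.trans ((ENNReal.div_le_div_right hprod _).trans ?_))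
  · intro zs hzs
    simp only [Set.mem_ofPred_eq] at hzs ⊢
    rw [← ENNReal.ofReal_prod_of_nonneg (fun i _ => (Real.exp_pos _).le), ← Real.exp_sum]
    exact ENNReal.ofReal_le_ofReal (Real.exp_le_exp.mpr hzs.le)
  · rw [← ENNReal.ofReal_div_of_pos (Real.exp_pos _), ← Real.exp_sub]
    apply le_of_eq
    congr 2
    ring

end Concentration

/-! ### Tails of power sums -/

section PowerSums

/-- A discrete form of comparing a sum with an integral. Dividing by `(x+1)^(1-s)` leaves a
Bernoulli inequality, obtained from `ln t ≤ t - 1` and `1 + u ≤ e^u`. The right side telescopes. -/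
theorem mul_rpow_neg_le_sub {s x : ℝ} (hs : 1 < s) (hx : 0 < x) :
    (s - 1) * (x + 1) ^ (-s) ≤ x ^ (1 - s) - (x + 1) ^ (1 - s) := by
  have hx1 : 0 < x + 1 := by linarith
  have hlog : Real.log (x / (x + 1)) ≤ -1 / (x + 1) := by
    have := Real.log_le_sub_one_of_pos (div_pos hx hx1)
    have h2 : x / (x + 1) - 1 = -1 / (x + 1) := by field_simp; ring
    linarith
  have hpow : 1 + (s - 1) / (x + 1) ≤ (x / (x + 1)) ^ (1 - s) := by
    rw [Real.rpow_def_of_pos (div_pos hx hx1)]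
    refine le_trans ?_ (Real.add_one_le_exp _)
    have := mul_le_mul_of_nonneg_left hlog (sub_pos.mpr hs).le
    have h3 : (s - 1) * (-1 / (x + 1)) = -((s - 1) / (x + 1)) := by ring
    linarith
  rw [Real.div_rpow hx.le hx1.le, le_div_iff₀ (Real.rpow_pos_of_pos hx1 _)] at hpow
  have h4 : (x + 1) ^ (-s) = (x + 1) ^ (1 - s) / (x + 1) := by
    rw [← Real.rpow_sub_one hx1.ne']
    congr 1
    ring
  rw [h4]
  have h5 : (1 + (s - 1) / (x + 1)) * (x + 1) ^ (1 - s) =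
      (x + 1) ^ (1 - s) + (s - 1) * ((x + 1) ^ (1 - s) / (x + 1)) := by ring
  linarith

theorem sum_range_rpow_neg_le {s : ℝ} (hs : 1 < s) {b : ℕ} (hb : 0 < b) (N : ℕ) :
    ∑ j ∈ Finset.range N, (if b ≤ j then ((j : ℝ) + 1) ^ (-s) else 0) ≤
      (b : ℝ) ^ (1 - s) / (s - 1) := by
  have hs' : 0 < s - 1 := sub_pos.mpr hs
  have hb' : (0 : ℝ) < b := by exact_mod_cast hb
  -- The `max` keeps the telescoped form valid while `N ≤ b`, where the sum is still zero.
  have key : ∀ N : ℕ, ∑ j ∈ Finset.range N, (if b ≤ j then ((j : ℝ) + 1) ^ (-s) else 0) ≤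
      ((b : ℝ) ^ (1 - s) - ((max b N : ℕ) : ℝ) ^ (1 - s)) / (s - 1) := by
    intro N
    induction N with
    | zero => simp
    | succ N ih =>
      rw [Finset.sum_range_succ]
      split_ifs with h
      · have hN : (0 : ℝ) < N := hb'.trans_le (by exact_mod_cast h)
        rw [max_eq_right h] at ih
        rw [max_eq_right (h.trans N.le_succ)]
        have := mul_rpow_neg_le_sub hs hN
        rw [le_div_iff₀ hs'] at ih ⊢
        push_cast
        linarith
      · rw [max_eq_left (by omega)] at ih ⊢
        simpa using ih
  refine (key N).trans (div_le_div_of_nonneg_right ?_ hs'.le)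
  linarith [Real.rpow_nonneg (Nat.cast_nonneg (α := ℝ) (max b N)) (1 - s)]

theorem tsum_ofReal_rpow_neg_le {s : ℝ} (hs : 1 < s) {b : ℕ} (hb : 0 < b) :
    ∑' j : ℕ, (if b ≤ j then ENNReal.ofReal (((j : ℝ) + 1) ^ (-s)) else 0) ≤
      ENNReal.ofReal ((b : ℝ) ^ (1 - s) / (s - 1)) := by
  rw [ENNReal.tsum_eq_iSup_nat]
  refine iSup_le fun N => ?_
  refine le_trans (le_of_eq ?_) (ENNReal.ofReal_le_ofReal (sum_range_rpow_neg_le hs hb N))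
  rw [ENNReal.ofReal_sum_of_nonneg]
  · refine Finset.sum_congr rfl fun j _ => ?_
    split_ifs <;> simp
  · intro j _
    split_ifs
    · positivity
    · rfl

theorem tsum_ofReal_rpow_neg_le' {s : ℝ} (hs : 1 < s) :
    ∑' j : ℕ, ENNReal.ofReal (((j : ℝ) + 1) ^ (-s)) ≤ ENNReal.ofReal (s / (s - 1)) := by
  have hs' : 0 < s - 1 := sub_pos.mpr hs
  have h := tsum_ofReal_rpow_neg_le hs one_pos
  rw [tsum_eq_zero_add' ENNReal.summable] at h ⊢
  simp only [Nat.cast_one, Real.one_rpow] at h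
  have h2 : s / (s - 1) = 1 + 1 / (s - 1) := by field_simp; ring
  rw [h2, ENNReal.ofReal_add zero_le_one (by positivity)]
  refine add_le_add (by simp) ?_
  simpa using h

end PowerSums

/-! ### Counting words and the outputs of a symmetric algorithm -/

section Counting

/-- A Kraft-type bound for the number of words of length `n` whose weight is at least `c`. -/
theorem finite_and_ncard_words_le {n : ℕ} {v : ℕ → ℝ} (hv : ∀ j, 0 ≤ v j) {V c : ℝ} (hc : 0 < c)
    (hV : ∀ N, ∑ j ∈ Finset.range N, v j ≤ V) (m : ℕ) :
    ({f : Fin n → ℕ | (∀ i, f i < m) ∧ c ≤ ∏ i, v (f i)}).Finite ∧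
      ({f : Fin n → ℕ | (∀ i, f i < m) ∧ c ≤ ∏ i, v (f i)}).ncard ≤ V ^ n / c := by
  set S : Finset (Fin n → ℕ) :=
    (Fintype.piFinset fun _ : Fin n => Finset.range m).filter fun f => c ≤ ∏ i, v (f i) with hS
  have hSS : {f : Fin n → ℕ | (∀ i, f i < m) ∧ c ≤ ∏ i, v (f i)} = (S : Set (Fin n → ℕ)) := by
    ext f
    simp [hS, Fintype.mem_piFinset]
  rw [hSS]
  refine ⟨S.finite_toSet, ?_⟩
  rw [Set.ncard_coe_finset, le_div_iff₀ hc]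
  calc (S.card : ℝ) * c = ∑ f ∈ S, c := by rw [Finset.sum_const, nsmul_eq_mul]
    _ ≤ ∑ f ∈ S, ∏ i, v (f i) := Finset.sum_le_sum fun f hf => (Finset.mem_filter.mp hf).2
    _ ≤ ∑ f ∈ Fintype.piFinset fun _ : Fin n => Finset.range m, ∏ i, v (f i) :=
        Finset.sum_le_sum_of_subset_of_nonneg (Finset.filter_subset _ _)
          fun f _ _ => Finset.prod_nonneg fun i _ => hv _
    _ = (∑ j ∈ Finset.range m, v j) ^ n := by
        rw [← Finset.prod_univ_sum, Finset.prod_const, Finset.card_univ, Fintype.card_fin]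
    _ ≤ V ^ n := pow_le_pow_left₀ (Finset.sum_nonneg fun j _ => hv j) (hV m) n

/-- Two sequences in which every value occurs equally often differ by a permutation. -/
theorem exists_perm_of_card_fiber_eq {α : Type*} {n : ℕ} [DecidableEq α] (f g : Fin n → α)
    (h : ∀ c, Fintype.card {i // f i = c} = Fintype.card {i // g i = c}) :
    ∃ σ : Equiv.Perm (Fin n), f = g ∘ σ := by
  have e : ∀ c, {i // f i = c} ≃ {i // g i = c} := fun c => Fintype.equivOfCardEq (h c)
  exact ⟨Equiv.ofFiberEquiv e, funext fun i => (Equiv.ofFiberEquiv_map e i).symm⟩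

variable {Z H : Type*}

/-- Replace all ranks below `b` by `0`. -/
def truncRank (b : ℕ) (φ : Z → ℕ) (z : Z) : ℕ := if φ z < b then 0 else φ z

/-- The outputs of a symmetric algorithm on a set of samples are at most as many as the codes of
these samples, which consist of the frequencies of the letters of rank below `b` and of the word
of all the other ranks. -/
theorem ncard_image_le_of_symmetric {A : List Z → H} (hA : IsSymmetricAlg A) {n b : ℕ}
    (φ : Z → ℕ) (hφ : Function.Injective φ) (G : Set (Fin n → Z)) (W : Set (Fin n → ℕ))
    (hW : W.Finite) (hGW : ∀ zs ∈ G, (fun i => truncRank b φ (zs i)) ∈ W) :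
    ((fun zs : Fin n → Z => A (List.ofFn zs)) '' G).Finite ∧
      ((fun zs : Fin n → Z => A (List.ofFn zs)) '' G).ncard ≤ (n + 1) ^ b * W.ncard := by
  classical
  set code : (Fin n → Z) → (Fin b → Fin (n + 1)) × (Fin n → ℕ) := fun zs =>
    (fun j => ⟨Fintype.card {i // φ (zs i) = j}, by
      have := Fintype.card_subtype_le fun i => φ (zs i) = j
      rw [Fintype.card_fin] at this
      omega⟩, fun i => truncRank b φ (zs i)) with hcode
  have hinj : ∀ zs zs' : Fin n → Z, code zs = code zs' → A (List.ofFn zs) = A (List.ofFn zs') := by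
    intro zs zs' h
    obtain ⟨h1, h2⟩ := Prod.ext_iff.mp h
    -- Frequencies below `b` are stored in the code. For `c ≥ b` the positions of `c` can be read
    -- off the word, since `0` marks only a truncated letter unless `b = 0`, when nothing is
    -- truncated.
    have hcard : ∀ c, Fintype.card {i // φ (zs i) = c} = Fintype.card {i // φ (zs' i) = c} := by
      intro c
      by_cases hc : c < b
      · exact congrArg Fin.val (congrFun h1 ⟨c, hc⟩)
      · refine Fintype.card_congr (Equiv.subtypeEquivRight fun i => ?_)
        have := congrFun h2 i
        simp only [hcode, truncRank] at this
        split_ifs at this <;> omega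
    obtain ⟨σ, hσ⟩ := exists_perm_of_card_fiber_eq (fun i => φ (zs i)) (fun i => φ (zs' i)) hcard
    have : zs = fun i => zs' (σ i) := funext fun i => hφ (congrFun hσ i)
    rw [this, ← hA]
  set T : Set ((Fin b → Fin (n + 1)) × (Fin n → ℕ)) := Set.univ ×ˢ W with hT
  have hTfin : T.Finite := Set.finite_univ.prod hW
  have hsub : code '' G ⊆ T := by
    rintro _ ⟨zs, hzs, rfl⟩
    exact ⟨Set.mem_univ _, hGW zs hzs⟩
  have hcfin : (code '' G).Finite := hTfin.subset hsub
  rcases G.eq_empty_or_nonempty with rfl | ⟨zs₀, -⟩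
  · simp
  have : Nonempty (Fin n → Z) := ⟨zs₀⟩
  -- One representative sample per code: the output factors through the code.
  choose! r hr using fun (c : (Fin b → Fin (n + 1)) × (Fin n → ℕ)) (hc : c ∈ code '' G) => hc
  have himg : (fun zs : Fin n → Z => A (List.ofFn zs)) '' G ⊆
      (fun c => A (List.ofFn (r c))) '' (code '' G) := by
    rintro _ ⟨zs, hzs, rfl⟩
    have hm : code zs ∈ code '' G := ⟨zs, hzs, rfl⟩
    exact ⟨code zs, hm, hinj _ _ (hr _ hm).2⟩
  have hfin2 := hcfin.image fun c => A (List.ofFn (r c))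
  refine ⟨hfin2.subset himg, ?_⟩
  calc _ ≤ ((fun c => A (List.ofFn (r c))) '' (code '' G)).ncard := Set.ncard_le_ncard himg hfin2
    _ ≤ (code '' G).ncard := Set.ncard_image_le hcfin
    _ ≤ T.ncard := Set.ncard_le_ncard hsub hTfin
    _ = (n + 1) ^ b * W.ncard := by
      rw [hT, Set.ncard_prod, Set.ncard_univ, Nat.card_eq_fintype_card, Fintype.card_fun]
      simp

end Counting

/-! ### The code for rare letters and the main union bound -/

section Core

/-- Weight of a letter of rank `j`: it vanishes below `b` and grows logarithmically above. -/
noncomputable def rankWeight (β : ℝ) (b j : ℕ) : ℝ := if j < b then 0 else 1 + β * Real.log (((j : ℝ) + 1) / b)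

/-- Sub-probability weights by which the truncated ranks are encoded. -/
noncomputable def kraftWeight (n b j : ℕ) : ℝ :=
  if j < b then (if j = 0 then 1 else 0) else (1 / (n : ℝ)) * ((b : ℝ) / (j + 1)) ^ 2

theorem log_rank_div_nonneg {b j : ℕ} (hb : 0 < b) (h : b ≤ j) :
    0 ≤ Real.log (((j : ℝ) + 1) / b) := by
  have hb' : (0 : ℝ) < b := by exact_mod_cast hb
  have hj : (b : ℝ) ≤ j := by exact_mod_cast h
  exact Real.log_nonneg (by rw [le_div_iff₀ hb']; linarith)

theorem rankWeight_nonneg {β : ℝ} (hβ : 0 ≤ β) {b : ℕ} (hb : 0 < b) (j : ℕ) :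
    0 ≤ rankWeight β b j := by
  unfold rankWeight
  split_ifs with h
  · rfl
  · have := mul_nonneg hβ (log_rank_div_nonneg hb (not_lt.mp h))
    linarith

theorem kraftWeight_nonneg (n b j : ℕ) : 0 ≤ kraftWeight n b j := by
  unfold kraftWeight
  split_ifs <;> positivity

/-- All truncated letters share the symbol `0` of weight `1`. The others contribute `(b²/n) ∑
(j+1)⁻²` over `j ≥ b`, at most `b/n`, so that the `n`-th power of the total stays below `e^b`. -/
theorem sum_range_kraftWeight_le {n b : ℕ} (hn : 0 < n) (hb : 0 < b) (N : ℕ) :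
    ∑ j ∈ Finset.range N, kraftWeight n b j ≤ 1 + b / n := by
  have hn' : (0 : ℝ) < n := by exact_mod_cast hn
  have hb' : (0 : ℝ) < b := by exact_mod_cast hb
  have h := sum_range_rpow_neg_le (s := 2) (by norm_num) hb N
  have h1 : ∀ j : ℕ, kraftWeight n b j ≤ (if j = 0 then 1 else 0) +
      (b : ℝ) ^ 2 / n * (if b ≤ j then ((j : ℝ) + 1) ^ (-(2 : ℝ)) else 0) := by
    intro j
    unfold kraftWeight
    by_cases hj : j < b
    · simp [hj, not_le.mpr hj]
    · rw [if_neg hj, if_pos (not_lt.mp hj)]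
      have hj1 : (0 : ℝ) < (j : ℝ) + 1 := by positivity
      have : ((j : ℝ) + 1) ^ (-(2 : ℝ)) = 1 / ((j : ℝ) + 1) ^ 2 := by
        rw [Real.rpow_neg hj1.le, one_div]
        norm_cast
      rw [this]
      have h0 : (0 : ℝ) ≤ if j = 0 then 1 else 0 := by split_ifs <;> norm_num
      have : (1 / (n : ℝ)) * ((b : ℝ) / (j + 1)) ^ 2 =
          (b : ℝ) ^ 2 / n * (1 / ((j : ℝ) + 1) ^ 2) := by field_simp
      linarith
  refine (Finset.sum_le_sum fun j _ => h1 j).trans ?_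
  rw [Finset.sum_add_distrib, ← Finset.mul_sum]
  have h2 : ∑ j ∈ Finset.range N, (if j = 0 then (1 : ℝ) else 0) ≤ 1 := by
    rw [Finset.sum_ite_eq']
    split_ifs <;> norm_num
  have h3 := mul_le_mul_of_nonneg_left h (show 0 ≤ (b : ℝ) ^ 2 / n by positivity)
  have h4 : (b : ℝ) ^ 2 / n * ((b : ℝ) ^ ((1 : ℝ) - 2) / (2 - 1)) = b / n := by
    rw [show (1 : ℝ) - 2 = -1 by norm_num, Real.rpow_neg_one]
    field_simp
    norm_num
  linarith

/-- The price `Λ` per unit of weight has two duties: `Λ ≥ ln n` pays for the factor `1/n` with the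
constant part of the weight, and `Λβ ≥ 2` pays for the square with the logarithmic part. -/
theorem exp_neg_le_kraftWeight {Z : Type*} {β Λ : ℝ} {n b : ℕ} (hn : 0 < n) (hb : 0 < b)
    (hΛ : Real.log n ≤ Λ) (hβΛ : 2 ≤ Λ * β) (φ : Z → ℕ) (z : Z) :
    Real.exp (-(Λ * rankWeight β b (φ z))) ≤ kraftWeight n b (truncRank b φ z) := by
  have hn' : (0 : ℝ) < n := by exact_mod_cast hn
  have hb' : (0 : ℝ) < b := by exact_mod_cast hb
  unfold truncRank rankWeight
  by_cases h : φ z < b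
  · simp [h, kraftWeight, hb]
  · rw [if_neg h, if_neg h, kraftWeight, if_neg h]
    have hl := log_rank_div_nonneg hb (not_lt.mp h)
    have hpos : (0 : ℝ) < ((φ z : ℝ) + 1) / b := by positivity
    have : (1 / (n : ℝ)) * ((b : ℝ) / (φ z + 1)) ^ 2 =
        Real.exp (-(Real.log n + 2 * Real.log (((φ z : ℝ) + 1) / b))) := by
      rw [neg_add, Real.exp_add, Real.exp_neg, Real.exp_log hn', Real.exp_neg, two_mul,
        Real.exp_add, Real.exp_log hpos]
      field_simp
    rw [this]
    apply Real.exp_le_exp.mpr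
    have := mul_le_mul_of_nonneg_right hβΛ hl
    nlinarith

variable {Z H : Type*} [MeasurableSpace Z] [DiscreteMeasurableSpace Z]

theorem lintegral_exp_rankWeight_le (Q : Measure Z) [IsProbabilityMeasure Q] {C γ : ℝ}
    (hC : 0 < C) (hγ : 1 < γ) (e : ℕ ≃ Z)
    (hq : ∀ j : ℕ, Q.real {e j} ≤ C * ((j : ℝ) + 1) ^ (-γ)) {b : ℕ} (hb : 0 < b) :
    ∫⁻ z, ENNReal.ofReal (Real.exp (rankWeight ((γ - 1) / 2) b (e.symm z))) ∂Q ≤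
      ENNReal.ofReal (1 + 2 * Real.exp 1 * C * (b : ℝ) ^ (1 - γ) / (γ - 1)) := by
  have hb' : (0 : ℝ) < b := by exact_mod_cast hb
  have hγ' : 0 < γ - 1 := sub_pos.mpr hγ
  have : Countable Z := e.symm.injective.countable
  rw [lintegral_countable', ← e.tsum_eq]
  simp only [Equiv.symm_apply_apply]
  -- Half of the available decay: `e^g` costs a factor `(j+1)^β`, and the remaining exponent `γ - β
  -- = (γ+1)/2` still exceeds `1`.
  set β := (γ - 1) / 2 with hβ
  set D : ℝ := Real.exp 1 * C * (b : ℝ) ^ (-β) with hD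
  have hterm : ∀ j : ℕ, ENNReal.ofReal (Real.exp (rankWeight β b j)) * Q {e j} ≤
      Q {e j} + ENNReal.ofReal D *
        (if b ≤ j then ENNReal.ofReal (((j : ℝ) + 1) ^ (-((γ + 1) / 2))) else 0) := by
    intro j
    unfold rankWeight
    by_cases h : j < b
    · simp [h, not_le.mpr h]
    · rw [if_neg h, if_pos (not_lt.mp h)]
      refine le_add_left ?_
      have hj : (0 : ℝ) < (j : ℝ) + 1 := by positivity
      rw [← ofReal_measureReal (measure_ne_top Q _), ← ENNReal.ofReal_mul (Real.exp_pos _).le,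
        ← ENNReal.ofReal_mul (by positivity)]
      refine ENNReal.ofReal_le_ofReal
        ((mul_le_mul_of_nonneg_left (hq j) (Real.exp_pos _).le).trans (le_of_eq ?_))
      rw [Real.exp_add, mul_comm β, ← Real.rpow_def_of_pos (by positivity),
        Real.div_rpow hj.le hb'.le, hD, Real.rpow_neg hb'.le,
        show -((γ + 1) / 2) = β + -γ by rw [hβ]; ring, Real.rpow_add hj]
      ring
  refine (ENNReal.tsum_le_tsum hterm).trans ?_
  rw [ENNReal.tsum_add, ENNReal.tsum_mul_left, e.tsum_eq fun z => Q {z}]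
  have h1 : ∑' z, Q {z} = 1 := by
    have := lintegral_countable' (μ := Q) fun _ => 1
    simpa using this.symm
  rw [h1, ENNReal.ofReal_add zero_le_one (by positivity), ENNReal.ofReal_one]
  gcongr
  refine (mul_le_mul_right (tsum_ofReal_rpow_neg_le (by linarith) hb) _).trans ?_
  rw [← ENNReal.ofReal_mul (by positivity)]
  refine ENNReal.ofReal_le_ofReal (le_of_eq ?_)
  have : (b : ℝ) ^ (1 - γ) = (b : ℝ) ^ (-β) * (b : ℝ) ^ (1 - (γ + 1) / 2) := by
    rw [← Real.rpow_add hb']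
    congr 1
    rw [hβ]
    ring
  rw [this, hD]
  have h2 : (γ + 1) / 2 - 1 = (γ - 1) / 2 := by ring
  rw [h2]
  field_simp

/-- The generalization bound for losses with values in a bounded interval. -/
theorem le_measure_genGap_le_of_mem_Icc {ℓ : H → Z → ℝ} {A : List Z → H} (hA : IsSymmetricAlg A)
    (Q : Measure Z) [IsProbabilityMeasure Q] {C γ : ℝ} (hC : 0 < C) (hγ : 1 < γ) (e : ℕ ≃ Z)
    (hq : ∀ j : ℕ, Q.real {e j} ≤ C * ((j : ℝ) + 1) ^ (-γ)) {lo hi : ℝ}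
    (hl : ∀ h z, ℓ h z ∈ Set.Icc lo hi) {n b : ℕ} (hn : 0 < n) (hb : 0 < b) {Λ L δ t : ℝ}
    (hΛ : Real.log n ≤ Λ) (hΛ' : 4 / (γ - 1) ≤ Λ) (hδ : 0 < δ) (ht : 0 ≤ t)
    (hcost : b * (Real.log (n + 1) + 1) +
      (n * (2 * Real.exp 1 * C * (b : ℝ) ^ (1 - γ) / (γ - 1)) + L) * Λ + Real.log (1 / δ) ≤
        2 * n * t ^ 2) :
    1 - (δ + Real.exp (-L)) ≤ (Measure.pi fun _ : Fin n => Q).real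
      {zs | genGap ℓ Q zs (A (List.ofFn zs)) ≤ (hi - lo) * t} := by
  have hn' : (0 : ℝ) < n := by exact_mod_cast hn
  have hb' : (0 : ℝ) < b := by exact_mod_cast hb
  have hγ' : 0 < γ - 1 := sub_pos.mpr hγ
  have : Countable Z := e.symm.injective.countable
  set β := (γ - 1) / 2 with hβ
  have hβ0 : 0 < β := by positivity
  set x : ℝ := 2 * Real.exp 1 * C * (b : ℝ) ^ (1 - γ) / (γ - 1) with hx
  set P := Measure.pi fun _ : Fin n => Q with hP
  set g : Z → ℝ := fun z => rankWeight β b (e.symm z) with hg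
  have hg0 : ∀ z, 0 ≤ g z := fun z => rankWeight_nonneg hβ0.le hb _
  have hβΛ : 2 ≤ Λ * β := by
    rw [div_le_iff₀ hγ'] at hΛ'
    rw [hβ]
    linarith
  have hΛ0 : 0 ≤ Λ := le_trans (by positivity) hΛ'
  set G : Set (Fin n → Z) := {zs | ∑ i, g (zs i) ≤ n * x + L} with hG
  have hGc : P.real Gᶜ ≤ Real.exp (-L) := by
    have := measure_sum_gt_le_exp Q n g (x := x) (L := L)
      (lintegral_exp_rankWeight_le Q hC hγ e hq hb)
    convert this using 3
    ext zs
    simp [hG]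
  set c : ℝ := Real.exp (-((n * x + L) * Λ)) with hc
  -- Each single weight is at most `nx + L`, which bounds every rank. The cutoff `m` only makes the
  -- set of words finite and does not enter the count.
  set m : ℕ := ⌈(b : ℝ) * Real.exp ((n * x + L) / β)⌉₊ + 1 with hm
  obtain ⟨hWfin, hWcard⟩ := finite_and_ncard_words_le (n := n) (kraftWeight_nonneg n b)
    (Real.exp_pos (-((n * x + L) * Λ))) (sum_range_kraftWeight_le hn hb) m
  set W : Set (Fin n → ℕ) := {f | (∀ i, f i < m) ∧ c ≤ ∏ i, kraftWeight n b (f i)} with hW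
  have hGW : ∀ zs ∈ G, (fun i => truncRank b e.symm (zs i)) ∈ W := by
    intro zs hzs
    have hzs' : ∑ i, g (zs i) ≤ n * x + L := hzs
    refine ⟨fun i => ?_, ?_⟩
    · have hi : g (zs i) ≤ n * x + L :=
        (Finset.single_le_sum (fun i _ => hg0 (zs i)) (Finset.mem_univ i)).trans hzs'
      simp only [truncRank]
      split_ifs with h
      · omega
      · simp only [hg, rankWeight, if_neg h] at hi
        have h1 : Real.log (((e.symm (zs i) : ℕ) + 1 : ℝ) / b) ≤ (n * x + L) / β := by
          rw [le_div_iff₀ hβ0]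
          linarith
        rw [Real.log_le_iff_le_exp (by positivity), div_le_iff₀ hb'] at h1
        have h2 := Nat.le_ceil ((b : ℝ) * Real.exp ((n * x + L) / β))
        have h3 : ((e.symm (zs i) : ℕ) : ℝ) < (m : ℕ) := by
          rw [hm]
          push_cast
          linarith
        exact_mod_cast h3
    · calc c ≤ Real.exp (∑ i, -(Λ * g (zs i))) := by
            apply Real.exp_le_exp.mpr
            rw [Finset.sum_neg_distrib, ← Finset.mul_sum]
            have := mul_le_mul_of_nonneg_left hzs' hΛ0
            linarith
        _ = ∏ i, Real.exp (-(Λ * g (zs i))) := Real.exp_sum _ _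
        _ ≤ ∏ i, kraftWeight n b (truncRank b e.symm (zs i)) :=
          Finset.prod_le_prod (fun i _ => (Real.exp_pos _).le)
            fun i _ => exp_neg_le_kraftWeight hn hb hΛ hβΛ _ _
  obtain ⟨hfin, hcard⟩ := ncard_image_le_of_symmetric hA e.symm e.symm.injective G W hWfin hGW
  have hbad := measure_genGap_gt_le_of_ncard_image ℓ Q hn ht hl
    (fun zs : Fin n → Z => A (List.ofFn zs)) G hfin
  have hbad' : P.real {zs | zs ∈ G ∧ (hi - lo) * t < genGap ℓ Q zs (A (List.ofFn zs))} ≤ δ := by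
    refine hbad.trans ?_
    have h1 : (((fun zs : Fin n → Z => A (List.ofFn zs)) '' G).ncard : ℝ) ≤
        ((n : ℝ) + 1) ^ b * ((1 + b / n) ^ n / c) := by
      refine (Nat.cast_le.mpr hcard).trans ?_
      push_cast
      gcongr
    have h2 : (1 + (b : ℝ) / n) ^ n ≤ Real.exp b := by
      calc (1 + (b : ℝ) / n) ^ n ≤ Real.exp (b / n) ^ n := by
            gcongr
            linarith [Real.add_one_le_exp ((b : ℝ) / n)]
        _ = Real.exp b := by
            rw [← Real.exp_nat_mul]
            congr 1
            field_simp
    have h3 : ((n : ℝ) + 1) ^ b = Real.exp (b * Real.log (n + 1)) := by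
      rw [mul_comm, Real.exp_mul, Real.exp_log (by positivity), Real.rpow_natCast]
    calc _ ≤ Real.exp (b * Real.log (n + 1)) * (Real.exp b / c) *
          Real.exp (-(2 * n * t ^ 2)) := by
          rw [← h3]
          gcongr
          refine h1.trans ?_
          gcongr
      _ = Real.exp (b * (Real.log (n + 1) + 1) + (n * x + L) * Λ - 2 * n * t ^ 2) := by
          rw [hc, ← Real.exp_sub, ← Real.exp_add, ← Real.exp_add]
          congr 1
          ring
      _ ≤ Real.exp (Real.log δ) := by
          apply Real.exp_le_exp.mpr
          rw [one_div, Real.log_inv] at hcost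
          linarith
      _ = δ := Real.exp_log hδ
  have hcover : {zs : Fin n → Z | genGap ℓ Q zs (A (List.ofFn zs)) ≤ (hi - lo) * t}ᶜ ⊆
      {zs | zs ∈ G ∧ (hi - lo) * t < genGap ℓ Q zs (A (List.ofFn zs))} ∪ Gᶜ := by
    intro zs hzs
    by_cases h : zs ∈ G
    · exact Or.inl ⟨h, not_le.mp hzs⟩
    · exact Or.inr h
  have hmeas := measureReal_mono (μ := P) hcover
  have hun := measureReal_union_le (μ := P)
    {zs | zs ∈ G ∧ (hi - lo) * t < genGap ℓ Q zs (A (List.ofFn zs))} Gᶜ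
  rw [probReal_compl_eq_one_sub MeasurableSet.of_discrete] at hmeas
  linarith

end Core

/-! ### Finite and infinite loss diameter -/

section LossDiam

/-- Reduces the extended-real statement to losses in a real interval; nonemptiness rules out the
degenerate values of the supremum and the infimum. -/
theorem lossDiam_eq_top_or_exists {Z H : Type*} [Nonempty Z] [Nonempty H] (ℓ : H → Z → ℝ) :
    lossDiam ℓ = ⊤ ∨ ∃ lo hi : ℝ, (∀ h z, ℓ h z ∈ Set.Icc lo hi) ∧
      lossDiam ℓ = ((hi - lo : ℝ) : EReal) := by
  obtain ⟨h₀⟩ := ‹Nonempty H›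
  obtain ⟨z₀⟩ := ‹Nonempty Z›
  have hsup : ∀ h z, (ℓ h z : EReal) ≤ ⨆ h, ⨆ z, (ℓ h z : EReal) :=
    fun h z => le_iSup₂ (f := fun h z => (ℓ h z : EReal)) h z
  have hinf : ∀ h z, ⨅ h, ⨅ z, (ℓ h z : EReal) ≤ (ℓ h z : EReal) :=
    fun h z => iInf₂_le (f := fun h z => (ℓ h z : EReal)) h z
  unfold lossDiam
  generalize (⨆ h, ⨆ z, (ℓ h z : EReal)) = S at *
  generalize (⨅ h, ⨅ z, (ℓ h z : EReal)) = I at *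
  induction S with
  | bot => exact absurd (hsup h₀ z₀) (by simp)
  | top =>
    left
    induction I with
    | bot => rfl
    | top => exact absurd (hinf h₀ z₀) (by simp)
    | coe lo => rfl
  | coe hi =>
    induction I with
    | bot => exact Or.inl rfl
    | top => exact absurd (hinf h₀ z₀) (by simp)
    | coe lo =>
      exact Or.inr ⟨lo, hi, fun h z => ⟨by exact_mod_cast hinf h z, by exact_mod_cast hsup h z⟩,
        rfl⟩

theorem genGap_le_of_mem_Icc {Z H : Type*} [MeasurableSpace Z] [DiscreteMeasurableSpace Z]
    {ℓ : H → Z → ℝ} (Q : Measure Z) [IsProbabilityMeasure Q] {lo hi : ℝ}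
    (hl : ∀ h z, ℓ h z ∈ Set.Icc lo hi) {n : ℕ} (hn : 0 < n) (zs : Fin n → Z) (h : H) :
    genGap ℓ Q zs h ≤ hi - lo := by
  have hn' : (0 : ℝ) < n := by exact_mod_cast hn
  have h1 : risk ℓ Q h ≤ hi := by
    have hint : Integrable (ℓ h) Q := Integrable.of_mem_Icc lo hi
      (Measurable.of_discrete).aemeasurable (Filter.Eventually.of_forall (hl h))
    have := integral_mono hint (integrable_const hi) fun z => (hl h z).2
    simpa [risk] using this
  have h2 : lo ≤ empRisk ℓ zs h := by
    have := Finset.sum_le_sum fun i (_ : i ∈ Finset.univ) => (hl h (zs i)).1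
    rw [Finset.sum_const, Finset.card_univ, Fintype.card_fin, nsmul_eq_mul] at this
    rw [empRisk, one_div, inv_mul_eq_div, le_div_iff₀ hn']
    linarith
  unfold genGap
  linarith

end LossDiam

/-! ### The bound at the cutoff `⌈n^(1/γ)⌉` -/

section Bound

variable {Z H : Type*} [MeasurableSpace Z] [DiscreteMeasurableSpace Z]

/-- If the target value exceeds the whole range of the loss, the gap never exceeds it. -/
theorem measure_genGap_le_eq_one (ℓ : H → Z → ℝ) (F : List Z → H) (Q : Measure Z)
    [IsProbabilityMeasure Q] [Nonempty Z] {n : ℕ} (hn : 0 < n) {t : ℝ} (ht : 1 ≤ t) :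
    (Measure.pi fun _ : Fin n => Q).real
      {zs | (genGap ℓ Q zs (F (List.ofFn zs)) : EReal) ≤ lossDiam ℓ * (t : ℝ)} = 1 := by
  have : Nonempty H := ⟨F []⟩
  have hall : {zs : Fin n → Z | (genGap ℓ Q zs (F (List.ofFn zs)) : EReal) ≤
      lossDiam ℓ * (t : ℝ)} = Set.univ := by
    refine Set.eq_univ_of_forall fun zs => ?_
    rcases lossDiam_eq_top_or_exists ℓ with h | ⟨lo, hi, hl, h⟩
    · simp only [Set.mem_ofPred_eq, h, EReal.top_mul_coe_of_pos (zero_lt_one.trans_le ht), le_top]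
    · have h1 := genGap_le_of_mem_Icc Q hl hn zs (F (List.ofFn zs))
      have h2 : 0 ≤ hi - lo := by
        obtain ⟨z₀⟩ := ‹Nonempty Z›
        have := hl (F []) z₀
        linarith [this.1, this.2]
      simp only [Set.mem_ofPred_eq, h]
      exact_mod_cast h1.trans (le_mul_of_one_le_right h2 ht)
  rw [hall, probReal_univ]

theorem two_mul_ceil_bound {x : ℝ} (hx : 1 ≤ x) : (⌈x⌉₊ : ℝ) ≤ 2 * x := by
  have := (Nat.ceil_lt_add_one (zero_le_one.trans hx)).le
  linarith

variable {ℓ : H → Z → ℝ} {A : List Z → H} {Q : Measure Z} [IsProbabilityMeasure Q] {C γ : ℝ}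

/-- The generalization bound with an explicit code length for power-law decay. -/
theorem le_measure_genGap_le (hA : IsSymmetricAlg A) (hC : 0 < C) (hγ : 1 < γ)
    (hQ : PowerLawDecay Q C γ) {n : ℕ} (hn : 2 ≤ n) {Λ L δ t : ℝ}
    (hΛ : Real.log n ≤ Λ) (hΛ' : 4 / (γ - 1) ≤ Λ) (hδ : 0 < δ) (ht : 0 < t)
    (hcost : 2 * (n : ℝ) ^ (1 / γ) * (2 * Real.log n + 1) +
      (2 * Real.exp 1 * (max C 1 * (n : ℝ) ^ (1 / γ) / (γ - 1)) + L) * Λ + Real.log (1 / δ) ≤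
        2 * n * t ^ 2) :
    1 - (δ + Real.exp (-L)) ≤ (Measure.pi fun _ : Fin n => Q).real
      {zs | (genGap ℓ Q zs (A (List.ofFn zs)) : EReal) ≤ lossDiam ℓ * (t : ℝ)} := by
  obtain ⟨e, hq⟩ := hQ
  have : Nonempty Z := ⟨e 0⟩
  have : Nonempty H := ⟨A []⟩
  rcases lossDiam_eq_top_or_exists ℓ with h | ⟨lo, hi, hl, h⟩
  · have : {zs : Fin n → Z | (genGap ℓ Q zs (A (List.ofFn zs)) : EReal) ≤
        lossDiam ℓ * (t : ℝ)} = Set.univ := by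
      simp [h, EReal.top_mul_coe_of_pos ht]
    rw [this, probReal_univ]
    linarith [Real.exp_pos (-L)]
  · have hγ' : 0 < γ - 1 := sub_pos.mpr hγ
    have hn0 : (0 : ℝ) < n := by positivity
    have hn1 : (1 : ℝ) ≤ n := by exact_mod_cast (by omega : 1 ≤ n)
    have hn2 : (2 : ℝ) ≤ n := by exact_mod_cast hn
    have hJ1 : 1 ≤ (n : ℝ) ^ (1 / γ) := Real.one_le_rpow hn1 (by positivity)
    have hb : 0 < ⌈(n : ℝ) ^ (1 / γ)⌉₊ := Nat.ceil_pos.mpr (by linarith)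
    have hJb := Nat.le_ceil ((n : ℝ) ^ (1 / γ))
    have hlog : Real.log ((n : ℝ) + 1) ≤ 2 * Real.log n := by
      rw [← Real.log_rpow hn0]
      refine Real.log_le_log (by linarith) ?_
      norm_cast
      nlinarith
    have hlogn : 0 ≤ Real.log n := Real.log_nonneg hn1
    have hlogn1 : 0 ≤ Real.log ((n : ℝ) + 1) := Real.log_nonneg (by linarith)
    have key := le_measure_genGap_le_of_mem_Icc (ℓ := ℓ) hA Q hC hγ e hq hl (by omega : 0 < n) hb
      (L := L) hΛ hΛ' hδ ht.le ?_
    · rw [h]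
      simpa only [← EReal.coe_mul, EReal.coe_le_coe_iff] using key
    · refine le_trans ?_ hcost
      have h1 : (⌈(n : ℝ) ^ (1 / γ)⌉₊ : ℝ) * (Real.log (n + 1) + 1) ≤
          2 * (n : ℝ) ^ (1 / γ) * (2 * Real.log n + 1) :=
        mul_le_mul (two_mul_ceil_bound hJ1) (by linarith) (by linarith) (by positivity)
      -- The choice of `b` balances the two costs: `n · (n^(1/γ))^(1-γ) = n^(1/γ)`.
      have h2 : (n : ℝ) * (⌈(n : ℝ) ^ (1 / γ)⌉₊ : ℝ) ^ (1 - γ) ≤ (n : ℝ) ^ (1 / γ) := by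
        calc (n : ℝ) * (⌈(n : ℝ) ^ (1 / γ)⌉₊ : ℝ) ^ (1 - γ)
            ≤ n * ((n : ℝ) ^ (1 / γ)) ^ (1 - γ) := by
              refine mul_le_mul_of_nonneg_left ?_ hn0.le
              exact Real.rpow_le_rpow_of_nonpos (by linarith) hJb (by linarith)
          _ = (n : ℝ) ^ (1 / γ) := by
              rw [← Real.rpow_mul hn0.le, mul_comm, ← Real.rpow_add_one hn0.ne']
              congr 1
              field_simp
              ring
      have h3 : (n : ℝ) * (2 * Real.exp 1 * C * (⌈(n : ℝ) ^ (1 / γ)⌉₊ : ℝ) ^ (1 - γ) / (γ - 1)) ≤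
          2 * Real.exp 1 * (max C 1 * (n : ℝ) ^ (1 / γ) / (γ - 1)) := by
        calc _ = 2 * Real.exp 1 * (C * ((n : ℝ) * (⌈(n : ℝ) ^ (1 / γ)⌉₊ : ℝ) ^ (1 - γ)) /
              (γ - 1)) := by ring
          _ ≤ _ := by
              gcongr
              exact le_max_left _ _
      have h4 : 0 ≤ Λ := le_trans (by positivity) hΛ'
      have h5 := mul_le_mul_of_nonneg_right (add_le_add_left h3 L) h4
      linarith

/-- Strictness of the cost inequality leaves room to replace `ε` by a slightly smaller `t`, by
continuity; positivity of the diameter then makes the gap bound strict. -/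
theorem le_measure_genGap_lt (hA : IsSymmetricAlg A) (hC : 0 < C) (hγ : 1 < γ)
    (hQ : PowerLawDecay Q C γ) {n : ℕ} (hn : 2 ≤ n) {Λ L δ ε : ℝ}
    (hΛ : Real.log n ≤ Λ) (hΛ' : 4 / (γ - 1) ≤ Λ) (hδ : 0 < δ) (hε : 0 < ε)
    (hdiam : 0 < lossDiam ℓ)
    (hcost : 2 * (n : ℝ) ^ (1 / γ) * (2 * Real.log n + 1) +
      (2 * Real.exp 1 * (max C 1 * (n : ℝ) ^ (1 / γ) / (γ - 1)) + L) * Λ + Real.log (1 / δ) <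
        2 * n * ε ^ 2) :
    1 - (δ + Real.exp (-L)) ≤ (Measure.pi fun _ : Fin n => Q).real
      {zs | (genGap ℓ Q zs (A (List.ofFn zs)) : EReal) < lossDiam ℓ * (ε : ℝ)} := by
  have hn0 : (0 : ℝ) < n := by positivity
  obtain ⟨t, ht0, htε, hcost'⟩ : ∃ t : ℝ, 0 < t ∧ t < ε ∧
      2 * (n : ℝ) ^ (1 / γ) * (2 * Real.log n + 1) +
      (2 * Real.exp 1 * (max C 1 * (n : ℝ) ^ (1 / γ) / (γ - 1)) + L) * Λ + Real.log (1 / δ) ≤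
        2 * n * t ^ 2 := by
    have hcont : Filter.Tendsto (fun t : ℝ => 2 * (n : ℝ) * t ^ 2) (nhdsWithin ε (Set.Iio ε))
        (nhds (2 * n * ε ^ 2)) :=
      (Continuous.tendsto (by fun_prop) ε).mono_left nhdsWithin_le_nhds
    have h1 := hcont.eventually (lt_mem_nhds hcost)
    have h2 : ∀ᶠ t in nhdsWithin ε (Set.Iio ε), 0 < t :=
      nhdsWithin_le_nhds (lt_mem_nhds hε)
    obtain ⟨t, h1, h2, h3⟩ := (h1.and (h2.and self_mem_nhdsWithin)).exists
    exact ⟨t, h2, h3, h1.le⟩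
  refine (le_measure_genGap_le (ℓ := ℓ) hA hC hγ hQ hn hΛ hΛ' hδ ht0 hcost').trans ?_
  refine measureReal_mono fun zs hzs => ?_
  simp only [Set.mem_ofPred_eq] at hzs ⊢
  obtain ⟨e, -⟩ := hQ
  have : Nonempty Z := ⟨e 0⟩
  have : Nonempty H := ⟨A []⟩
  rcases lossDiam_eq_top_or_exists ℓ with h | ⟨lo, hi, hl, h⟩
  · rw [h, EReal.top_mul_coe_of_pos hε]
    exact EReal.coe_lt_top _
  · refine hzs.trans_lt ?_
    rw [h] at hdiam ⊢
    have hpos : 0 < hi - lo := by exact_mod_cast hdiam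
    exact_mod_cast mul_lt_mul_of_pos_left htε hpos

end Bound

/-! ### The entropy bound on `κ*` -/

section Kappa

variable {Z : Type*} [MeasurableSpace Z]

theorem kappa_one (Q : Measure Z) (n : ℕ) : kappa Q 1 n = n := by
  simp [kappa]

theorem kappa_of_mem_Ioo (Q : Measure Z) {α : ℝ} (h0 : 0 < α) (h1 : α < 1) (n : ℕ) :
    kappa Q α n = (n : ℝ≥0∞) ^ α * ∑' z, Q {z} ^ α := by
  have hr : (ENNReal.ofReal α).toReal = α := ENNReal.toReal_ofReal h0.le
  have hne : (1 - α) ≠ 0 := by linarith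
  rw [kappa, renyiEntropy, if_neg, if_neg, if_neg ENNReal.ofReal_ne_top, hr, ← mul_assoc,
    ← EReal.coe_mul, mul_one_div_cancel hne, EReal.coe_one, one_mul, ENNReal.exp_log]
  · simpa using h0
  · rw [ENNReal.ofReal_eq_one]
    exact h1.ne

theorem kappaStar_le (Q : Measure Z) [IsFiniteMeasure Q] {C γ : ℝ} (hC : 0 < C) (hγ : 1 < γ)
    (hQ : PowerLawDecay Q C γ) {n : ℕ} (hn : 0 < n) :
    kappaStar Q n ≤ ENNReal.ofReal (powerLawKappaBound C γ n) := by
  have hn0 : (0 : ℝ) < n := by exact_mod_cast hn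
  have hn1 : (1 : ℝ) ≤ n := by exact_mod_cast hn
  have hγ' : 0 < γ - 1 := sub_pos.mpr hγ
  have hγ0 : 0 < γ := by linarith
  have hlogn : 0 ≤ Real.log n := Real.log_nonneg hn1
  obtain ⟨e, hq⟩ := hQ
  have hC1 : 1 ≤ max C 1 := le_max_right _ _
  have hJ0 : 0 < (n : ℝ) ^ (1 / γ) := Real.rpow_pos_of_pos hn0 _
  -- The threshold is where `1/γ + 1/ln n` reaches `1`. Below it `n ≤ e n^(1/γ)`, so `α = 1` with `κ
  -- = n` is enough.
  rcases le_or_gt (Real.log n) (γ / (γ - 1)) with hsmall | hlarge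
  · refine (iInf₂_le (1 : ℝ) (by simp)).trans ?_
    rw [kappa_one, ← ENNReal.ofReal_natCast]
    refine ENNReal.ofReal_le_ofReal ?_
    have h1 : (n : ℝ) ≤ Real.exp 1 * (n : ℝ) ^ (1 / γ) := by
      rw [Real.rpow_def_of_pos hn0, ← Real.exp_add]
      nth_rw 1 [← Real.exp_log hn0]
      apply Real.exp_le_exp.mpr
      rw [le_div_iff₀ hγ'] at hsmall
      have : 1 + Real.log n * (1 / γ) - Real.log n = (γ - Real.log n * (γ - 1)) / γ := by
        field_simp
        ring
      have : 0 ≤ (γ - Real.log n * (γ - 1)) / γ := div_nonneg (by linarith) hγ0.le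
      linarith
    have h2 : 1 ≤ (Real.log n + γ) / (γ - 1) := by
      rw [le_div_iff₀ hγ']
      linarith
    calc (n : ℝ) ≤ Real.exp 1 * (n : ℝ) ^ (1 / γ) * (1 * 1) := by linarith
      _ ≤ Real.exp 1 * (n : ℝ) ^ (1 / γ) * (max C 1 * ((Real.log n + γ) / (γ - 1))) := by gcongr
      _ = powerLawKappaBound C γ n := by
        rw [powerLawKappaBound]
        ring
  · have hlog0 : 0 < Real.log n := lt_trans (by positivity) hlarge
    -- With this `α`, `n^α = e n^(1/γ)`, and the series of `(j+1)^(-γα)` has exponent `1 + γ/ln n`,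
    -- hence sum at most `(ln n + γ)/γ`.
    set α : ℝ := 1 / γ + 1 / Real.log n with hα
    have hα0 : 0 < α := by positivity
    have hα1 : α < 1 := by
      have h1 : 1 / Real.log n < (γ - 1) / γ := by
        rw [div_lt_div_iff₀ hlog0 hγ0]
        rw [div_lt_iff₀ hγ'] at hlarge
        linarith
      have h2 : 1 / γ + (γ - 1) / γ = 1 := by field_simp; ring
      linarith
    refine (iInf₂_le α ⟨hα0.le, hα1.le⟩).trans ?_
    rw [kappa_of_mem_Ioo Q hα0 hα1, ← e.tsum_eq]
    have hγα : γ * α = 1 + γ / Real.log n := by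
      rw [hα]
      field_simp
    have hs : 1 < γ * α := by
      rw [hγα]
      have : 0 < γ / Real.log n := by positivity
      linarith
    have hterm : ∀ j : ℕ, Q {e j} ^ α ≤
        ENNReal.ofReal (max C 1) * ENNReal.ofReal (((j : ℝ) + 1) ^ (-(γ * α))) := by
      intro j
      have hj : (0 : ℝ) < (j : ℝ) + 1 := by positivity
      rw [← ofReal_measureReal (measure_ne_top Q _),
        ENNReal.ofReal_rpow_of_nonneg measureReal_nonneg hα0.le,
        ← ENNReal.ofReal_mul (by positivity)]
      refine ENNReal.ofReal_le_ofReal ?_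
      calc Q.real {e j} ^ α ≤ (max C 1 * ((j : ℝ) + 1) ^ (-γ)) ^ α := by
            refine Real.rpow_le_rpow measureReal_nonneg ((hq j).trans ?_) hα0.le
            gcongr
            exact le_max_left _ _
        _ = max C 1 ^ α * ((j : ℝ) + 1) ^ (-(γ * α)) := by
            rw [Real.mul_rpow (by positivity) (by positivity), ← Real.rpow_mul hj.le, neg_mul]
        _ ≤ max C 1 ^ (1 : ℝ) * ((j : ℝ) + 1) ^ (-(γ * α)) := by gcongr
        _ = max C 1 * ((j : ℝ) + 1) ^ (-(γ * α)) := by rw [Real.rpow_one]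
    have hsum : ∑' j : ℕ, Q {e j} ^ α ≤
        ENNReal.ofReal (max C 1) * ENNReal.ofReal (γ * α / (γ * α - 1)) := by
      refine (ENNReal.tsum_le_tsum hterm).trans ?_
      rw [ENNReal.tsum_mul_left]
      exact mul_le_mul_right (tsum_ofReal_rpow_neg_le' hs) _
    have hγα0 : 0 < γ * α - 1 := by linarith
    refine (mul_le_mul_right hsum _).trans ?_
    rw [← ENNReal.ofReal_natCast, ENNReal.ofReal_rpow_of_nonneg hn0.le hα0.le,
      ← ENNReal.ofReal_mul (by positivity), ← ENNReal.ofReal_mul (by positivity)]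
    refine ENNReal.ofReal_le_ofReal ?_
    have h1 : (n : ℝ) ^ α = Real.exp 1 * (n : ℝ) ^ (1 / γ) := by
      rw [hα, Real.rpow_add hn0, mul_comm]
      congr 1
      rw [Real.rpow_def_of_pos hn0, mul_one_div_cancel hlog0.ne']
    have h2 : γ * α / (γ * α - 1) = (Real.log n + γ) / γ := by
      rw [hγα, add_sub_cancel_left]
      field_simp
    rw [h1, h2, powerLawKappaBound]
    calc Real.exp 1 * (n : ℝ) ^ (1 / γ) * (max C 1 * ((Real.log n + γ) / γ))
        ≤ Real.exp 1 * (n : ℝ) ^ (1 / γ) * (max C 1 * ((Real.log n + γ) / (γ - 1))) := by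
          gcongr
          linarith
      _ = _ := by ring

end Kappa

/-! ### Numerical comparison of the code length with the stated bounds -/

section Estimates

/-- The tangent bound `ln t ≤ t - 1` at `t = z/(2c)` gives `c ln z < z/2 + c ln c`; the hypothesis
bounds the last term by `z/2`. -/
theorem mul_log_lt_of_two_mul_log_lt {c z : ℝ} (hc : 0 < c) (hz : 0 < z)
    (h : 2 * c * max (Real.log c) 0 < z) : c * Real.log z < z := by
  have h1 := Real.log_le_sub_one_of_pos (div_pos hz (mul_pos two_pos hc))
  rw [Real.log_div hz.ne' (by positivity), Real.log_mul two_ne_zero hc.ne'] at h1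
  have h2 := mul_le_mul_of_nonneg_left h1 hc.le
  have h3 : c * (z / (2 * c) - 1) = z / 2 - c := by field_simp
  have h4 := mul_le_mul_of_nonneg_left (le_max_left (Real.log c) 0) hc.le
  have h5 := mul_lt_mul_of_pos_left (Real.log_two_lt_d9.trans (by norm_num : _ < (1 : ℝ))) hc
  linarith

theorem one_le_log_two_pi : 1 ≤ Real.log (2 * Real.pi) := by
  rw [Real.le_log_iff_exp_le (by positivity)]
  linarith [Real.exp_one_lt_d9, Real.pi_gt_three]

section Power

variable {γ : ℝ} {n : ℕ}

theorem rpow_mul_rpow_eq_self (hγ : 1 < γ) (hn : 0 < n) :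
    (n : ℝ) ^ (1 / γ) * (n : ℝ) ^ ((γ - 1) / γ) = n := by
  rw [← Real.rpow_add (by exact_mod_cast hn)]
  have : 1 / γ + (γ - 1) / γ = 1 := by
    have : γ ≠ 0 := by linarith
    field_simp
    ring
  rw [this, Real.rpow_one]

theorem log_rpow_eq (hn : 0 < n) :
    Real.log ((n : ℝ) ^ ((γ - 1) / γ)) = (γ - 1) / γ * Real.log n :=
  Real.log_rpow (by exact_mod_cast hn) _

theorem lt_rpow_of_rpow_lt (hγ : 1 < γ) {a : ℝ} (ha : 0 ≤ a)
    (h : a ^ (γ / (γ - 1)) < n) : a < (n : ℝ) ^ ((γ - 1) / γ) := by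
  have hγ' : 0 < γ - 1 := sub_pos.mpr hγ
  have h1 := Real.rpow_lt_rpow (Real.rpow_nonneg ha _) h (show 0 < (γ - 1) / γ by positivity)
  rwa [← Real.rpow_mul ha, div_mul_div_comm, mul_comm, div_self (by positivity),
    Real.rpow_one] at h1

theorem le_rpow_of_rpow_le (hγ : 1 < γ) {a : ℝ} (ha : 0 ≤ a)
    (h : a ^ (γ / (γ - 1)) ≤ n) : a ≤ (n : ℝ) ^ ((γ - 1) / γ) := by
  have hγ' : 0 < γ - 1 := sub_pos.mpr hγ
  have h1 := Real.rpow_le_rpow (Real.rpow_nonneg ha _) h (show 0 ≤ (γ - 1) / γ by positivity)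
  rwa [← Real.rpow_mul ha, div_mul_div_comm, mul_comm, div_self (by positivity),
    Real.rpow_one] at h1

/-- A lower bound on `n ^ ((γ - 1) / γ)` bounds `1 / (γ - 1)` by a multiple of `ln n`. -/
theorem four_div_le_of_exp_le (hγ : 1 < γ) (hn : 0 < n) {u : ℝ} (hu : 0 < u)
    (h : Real.exp u ≤ (n : ℝ) ^ ((γ - 1) / γ)) :
    u ≤ Real.log n ∧ 4 / (γ - 1) ≤ 4 / u * Real.log n := by
  have hγ' : 0 < γ - 1 := sub_pos.mpr hγ
  have hlogn : 0 ≤ Real.log n := Real.log_nonneg (by exact_mod_cast hn)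
  have h1 := (Real.le_log_iff_exp_le (Real.rpow_pos_of_pos (by exact_mod_cast hn) _)).mpr h
  rw [log_rpow_eq hn, div_mul_eq_mul_div, le_div_iff₀ (by linarith)] at h1
  constructor
  · by_contra hlt
    nlinarith
  · rw [div_mul_eq_mul_div, div_le_div_iff₀ hγ' hu]
    nlinarith

end Power

/-- In the regime in which the explicit bound is nontrivial, it dominates the code length. -/
theorem codeLength_le_explicit {C γ : ℝ} (hγ : 1 < γ) {n : ℕ} (hn : 2 ≤ n) {M L L₂ s D : ℝ}
    (hM : 3 * Real.log n + 1 ≤ M) (hL0 : 0 ≤ L) (hL : L ≤ L₂) (hs : s = √((n : ℝ) / 2 * L₂))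
    (hD : 0 ≤ D) (hlt : (powerLawKappaBound C γ n + s) * M + D < 2 * n) :
    ∃ Λ, Real.log n ≤ Λ ∧ 4 / (γ - 1) ≤ Λ ∧ 2 * (n : ℝ) ^ (1 / γ) * (2 * Real.log n + 1) +
      (2 * Real.exp 1 * (max C 1 * (n : ℝ) ^ (1 / γ) / (γ - 1)) + L) * Λ + D ≤
        (powerLawKappaBound C γ n + s) * M + D := by
  have hn0 : (0 : ℝ) < n := by positivity
  have hn1 : (1 : ℝ) ≤ n := by exact_mod_cast (by omega : 1 ≤ n)
  have hγ' : 0 < γ - 1 := sub_pos.mpr hγ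
  have hC1 : 1 ≤ max C 1 := le_max_right _ _
  have he := Real.exp_one_gt_d9
  have he' := Real.exp_one_lt_d9
  have hl2 : 0.6931471803 < Real.log n :=
    Real.log_two_gt_d9.trans_le (Real.log_le_log two_pos (by exact_mod_cast hn))
  have hxy := rpow_mul_rpow_eq_self hγ (by omega : 0 < n)
  have hx1 : 1 ≤ (n : ℝ) ^ (1 / γ) := Real.one_le_rpow hn1 (by positivity)
  have hs0 : 0 ≤ s := hs ▸ Real.sqrt_nonneg _
  have hs2 : s ^ 2 = n / 2 * L₂ := by
    rw [hs, Real.sq_sqrt (mul_nonneg (by positivity) (hL0.trans hL))]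
  have hexp : ∀ u, 0 < u → Real.exp u ≤ (n : ℝ) ^ ((γ - 1) / γ) →
    u ≤ Real.log n ∧ 4 / (γ - 1) ≤ 4 / u * Real.log n :=
    fun u => four_div_le_of_exp_le hγ (by omega)
  set l := Real.log n with hl
  set x := (n : ℝ) ^ (1 / γ) with hx
  set y := (n : ℝ) ^ ((γ - 1) / γ) with hy
  set m := max C 1 * x / (γ - 1) with hm
  have hk : powerLawKappaBound C γ n = Real.exp 1 * m * (l + γ) := by
    rw [powerLawKappaBound, hm]
    ring
  rw [hk] at hlt ⊢
  have hmx : x ≤ m * (γ - 1) := by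
    rw [hm, div_mul_cancel₀ _ hγ'.ne']
    have := mul_le_mul_of_nonneg_right hC1 (show 0 ≤ x by positivity)
    linarith
  have hm0 : 0 < m := by positivity
  have hM0 : 0 < M := by linarith
  have hsM : 0 ≤ s * M := mul_nonneg hs0 hM0.le
  have hkM : Real.exp 1 * m * (l + γ) * M < 2 * (x * y) := by
    rw [hxy]
    linarith
  -- Nontriviality of the bound forces `n` to be large: `k(n) ≥ e x`, and `xy = n`.
  have heM : Real.exp 1 * M < 2 * y := by
    have h1 : x ≤ m * (l + γ) := hmx.trans (mul_le_mul_of_nonneg_left (by linarith) hm0.le)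
    have h2 := mul_le_mul_of_nonneg_right h1 (show 0 ≤ Real.exp 1 * M by positivity)
    by_contra hcon
    have h3 := mul_le_mul_of_nonneg_left (not_lt.mp hcon) (show 0 ≤ x by positivity)
    linarith
  -- Bootstrap: `M ≥ 2` gives `ln n ≥ 1`, hence `M ≥ 4`, hence `y ≥ 2e ≥ e^(3/2)` and `ln n ≥ 3/2`.
  -- The price is then `Λ = (8/3) ln n`, where `8/3 = 4/(3/2)`.
  obtain ⟨hl1, -⟩ := hexp 1 one_pos (by
    have := mul_le_mul_of_nonneg_left (show 2 ≤ M by linarith) (Real.exp_pos 1).le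
    linarith)
  have hhalf : Real.exp (3 / 2) ≤ 2 * Real.exp 1 := by
    have h1 : Real.exp (1 / 2) ≤ 2 := by
      have h2 : Real.exp (1 / 2) ^ 2 = Real.exp 1 := by
        rw [← Real.exp_nat_mul]
        norm_num
      refine abs_le_of_sq_le_sq' (by linarith) two_pos.le |>.2
    have h3 : Real.exp (3 / 2) = Real.exp (1 / 2) * Real.exp 1 := by
      rw [← Real.exp_add]
      norm_num
    rw [h3]
    exact mul_le_mul_of_nonneg_right h1 (Real.exp_pos _).le
  obtain ⟨hl32, hΛ⟩ := hexp (3 / 2) (by norm_num) (by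
    have := mul_le_mul_of_nonneg_left (show 4 ≤ M by linarith) (Real.exp_pos 1).le
    linarith)
  refine ⟨8 / 3 * l, by linarith, hΛ.trans (le_of_eq (by norm_num)), ?_⟩
  -- Since `s² = (n/2) L₂`, multiplying `sM ≤ 2n` by `s` gives `L₂ M ≤ 4s`. Thus the term `LΛ` fits
  -- into the term `sM` of the explicit bound.
  have hLM : L * M ≤ 4 * s := by
    have h1 : s * M ≤ 2 * n := by
      have : 0 ≤ Real.exp 1 * m * (l + γ) * M := by positivity
      linarith
    have h2 := mul_le_mul_of_nonneg_left h1 hs0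
    have h3 : n * (L₂ * M) ≤ n * (4 * s) := by
      have h5 : s * (s * M) = n / 2 * L₂ * M := by
        rw [← hs2]
        ring
      linarith
    have h4 := le_of_mul_le_mul_left h3 hn0
    exact (mul_le_mul_of_nonneg_right hL hM0.le).trans h4
  have hLl : L * l * 3 ≤ 4 * s := by
    have := mul_le_mul_of_nonneg_left (show 3 * l ≤ M by linarith) hL0
    linarith
  have hsM' : s * 5 ≤ s * M := mul_le_mul_of_nonneg_left (by linarith) hs0
  have hA : 2 * x * (2 * l + 1) ≤ Real.exp 1 * m * γ * M := by
    have h1 : x ≤ m * γ := hmx.trans (mul_le_mul_of_nonneg_left (by linarith) hm0.le)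
    have h2 : 4 * l + 2 ≤ Real.exp 1 * M := by
      have := mul_le_mul_of_nonneg_right (show 2 ≤ Real.exp 1 by linarith) hM0.le
      linarith
    have := mul_le_mul h1 h2 (by positivity) (by positivity)
    linarith
  have hB : 2 * Real.exp 1 * m * (8 / 3 * l) ≤ Real.exp 1 * m * l * M := by
    have h1 : 16 / 3 ≤ M := by linarith
    have := mul_le_mul_of_nonneg_left h1 (show 0 ≤ Real.exp 1 * m * l by positivity)
    linarith
  linarith

/-- The explicit data length makes the code length smaller than `2 n ε²`. -/
theorem codeLength_lt_of_lt {C γ : ℝ} (hγ : 1 < γ) {n : ℕ} {δ ε : ℝ}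
    (hδ : δ ∈ Set.Ioc (0 : ℝ) 1) (hε : ε ∈ Set.Ioc (0 : ℝ) 1) (hω : omega δ ε < n)
    (hlen : powerLawLength C γ δ ε < n) :
    2 ≤ n ∧ ∃ Λ, Real.log n ≤ Λ ∧ 4 / (γ - 1) ≤ Λ ∧
      2 * (n : ℝ) ^ (1 / γ) * (2 * Real.log n + 1) +
      (2 * Real.exp 1 * (max C 1 * (n : ℝ) ^ (1 / γ) / (γ - 1)) + Real.log (3 / δ)) * Λ +
        Real.log (3 / δ) < 2 * n * ε ^ 2 := by
  obtain ⟨hδ0, hδ1⟩ := hδ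
  obtain ⟨hε0, hε1⟩ := hε
  have hγ' : 0 < γ - 1 := sub_pos.mpr hγ
  have hC1 : 1 ≤ max C 1 := le_max_right _ _
  have he := Real.exp_one_gt_d9
  have he' := Real.exp_one_lt_d9
  have hε2 : ε ^ 2 ≤ 1 := pow_le_one₀ hε0.le hε1
  have hε2' : 0 < ε ^ 2 := by positivity
  have hL1 : 1 ≤ Real.log (3 / δ) := by
    rw [Real.le_log_iff_exp_le (by positivity)]
    have : 3 ≤ 3 / δ := by rw [le_div_iff₀ hδ0]; linarith
    linarith
  have hP : Real.log (2 * Real.pi / (δ / 3)) = Real.log (2 * Real.pi) + Real.log (3 / δ) := by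
    rw [← Real.log_mul (by positivity) (by positivity)]
    congr 1
    field_simp
  have hP2 : 2 ≤ Real.log (2 * Real.pi / (δ / 3)) := by linarith [one_le_log_two_pi]
  unfold omega at hω
  unfold powerLawLength powerLawLength₂ powerLawLength₃ powerLawBase₂ at hlen
  have hω1 := (le_max_left _ _).trans_lt hω
  have hω2 := (le_max_right _ _).trans_lt hω
  have hlen2 := ((le_max_left _ _).trans (le_max_right _ _)).trans_lt hlen
  have hlen3 := ((le_max_right _ _).trans (le_max_right _ _)).trans_lt hlen
  clear hω hlen
  set L := Real.log (3 / δ) with hL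
  set P := Real.log (2 * Real.pi / (δ / 3)) with hPdef
  have h15 : 3 / 2 * L < n * ε ^ 2 := by
    have : 3 / (2 * ε ^ 2) * L = (3 / 2 * L) / ε ^ 2 := by field_simp
    rwa [this, div_lt_iff₀ hε2'] at hω2
  have hn0 : (0 : ℝ) < n := by
    by_contra hcon
    nlinarith
  have hn : 2 ≤ n := by
    have : (1 : ℝ) < n := by
      by_contra hcon
      nlinarith
    exact_mod_cast this
  have hn1 : (1 : ℝ) ≤ n := by exact_mod_cast (by omega : 1 ≤ n)
  refine ⟨hn, ?_⟩
  have hnpos : 0 < n := by omega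
  have hexp := four_div_le_of_exp_le hγ hnpos (show (0 : ℝ) < 3 by norm_num)
  have hxy := rpow_mul_rpow_eq_self hγ hnpos
  have hlogy := log_rpow_eq (γ := γ) hnpos
  have hx1 : 1 ≤ (n : ℝ) ^ (1 / γ) := Real.one_le_rpow hn1 (by positivity)
  have hy0 : 0 < (n : ℝ) ^ ((γ - 1) / γ) := Real.rpow_pos_of_pos hn0 _
  -- lower bound on `n` from the third term
  have h3 := lt_rpow_of_rpow_lt hγ (by positivity) hlen3
  -- lower bound on `n` from the second term
  set b₂ := 6 * Real.exp 1 * max C 1 / (2 * ε ^ 2) *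
    (3 * γ / (γ - 1) + 1 / (γ - 1) * P) with hb₂
  have hb₂0 : 0 < b₂ := by positivity
  have h2 : b₂ * Real.log n < (n : ℝ) ^ ((γ - 1) / γ) := by
    rw [← Real.mul_rpow hb₂0.le (by positivity)] at hlen2
    have h := lt_rpow_of_rpow_lt hγ (by positivity) hlen2
    have hc : 0 < γ / (γ - 1) * b₂ := by positivity
    have := mul_log_lt_of_two_mul_log_lt hc hy0 (by
      rw [Real.log_mul (by positivity) hb₂0.ne']
      refine lt_of_eq_of_lt ?_ h
      ring)
    rw [hlogy] at this
    refine lt_of_eq_of_lt ?_ this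
    field_simp
  -- lower bound on `n` from the function `ω`
  have h1 : 20 * L * Real.log n ^ 2 < n * ε ^ 4 := by
    -- The logarithmic inequality is applied to `z = √n` and then squared.
    set c := 9 * √L / ε ^ 2 with hc
    have hsL : 1 ≤ √L := Real.one_le_sqrt.mpr hL1
    have hc1 : 1 ≤ c := by
      rw [hc, le_div_iff₀ hε2']
      linarith
    have hc0 : 0 < c := by linarith
    have hlogc : 0 ≤ Real.log c := Real.log_nonneg hc1
    have hle : Real.log c ≤ Real.log (9 * √(2 * L) / ε ^ 2) := by
      refine Real.log_le_log hc0 ?_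
      rw [hc]
      gcongr
      linarith
    have hc2 : c ^ 2 = 81 * L / ε ^ 4 := by
      rw [hc, div_pow, mul_pow, Real.sq_sqrt (by linarith)]
      ring
    have hsq : (2 * c * Real.log c) ^ 2 < n := by
      refine lt_of_le_of_lt ?_ hω1
      have : (2 * c * Real.log c) ^ 2 = 324 * L / ε ^ 4 * Real.log c ^ 2 := by
        rw [mul_pow, mul_pow, hc2]
        ring
      rw [this]
      gcongr
    have h := mul_log_lt_of_two_mul_log_lt hc0 (Real.sqrt_pos.mpr hn0) (by
      rw [max_eq_left hlogc]
      exact Real.lt_sqrt_of_sq_lt hsq)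
    rw [Real.log_sqrt hn0.le] at h
    have hlogn : 0 ≤ Real.log n := Real.log_nonneg hn1
    have h' := pow_lt_pow_left₀ h (by positivity) two_ne_zero
    rw [Real.sq_sqrt hn0.le, mul_pow, hc2] at h'
    have : 81 * L / ε ^ 4 * (Real.log n / 2) ^ 2 = (81 / 4 * L * Real.log n ^ 2) / ε ^ 4 := by
      ring
    rw [this, div_lt_iff₀ (by positivity)] at h'
    have : 0 ≤ L * Real.log n ^ 2 := by positivity
    linarith
  set l := Real.log n with hl
  set x := (n : ℝ) ^ (1 / γ) with hx
  set y := (n : ℝ) ^ ((γ - 1) / γ) with hy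
  set m := max C 1 * x / (γ - 1) with hm
  have hm0 : 0 < m := by positivity
  have hl0 : 0 ≤ l := Real.log_nonneg hn1
  -- The third length gives `y > 12e ≥ e³`, so `ln n ≥ 3` and `Λ = (4/3) ln n` is admissible.
  have hy12 : Real.exp 3 ≤ y := by
    have h4 : 12 * Real.exp 1 ≤
        6 * Real.exp 1 * max C 1 * γ / (ε ^ 2 * (γ - 1)) * P := by
      have h5 : 1 ≤ γ / (γ - 1) := by rw [le_div_iff₀ hγ']; linarith
      have h6 : 1 ≤ 1 / ε ^ 2 := by rw [le_div_iff₀ hε2']; linarith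
      calc 12 * Real.exp 1 = 6 * Real.exp 1 * (1 * 1 * 1 * 2) := by ring
        _ ≤ 6 * Real.exp 1 * (max C 1 * (γ / (γ - 1)) * (1 / ε ^ 2) * P) := by gcongr
        _ = _ := by field_simp
    have h7 : Real.exp 3 = Real.exp 1 ^ 3 := by
      rw [← Real.exp_nat_mul]
      norm_num
    have h8 : Real.exp 1 ^ 2 ≤ 12 :=
      (pow_le_pow_left₀ (Real.exp_pos 1).le he'.le 2).trans (by norm_num)
    have h9 := mul_le_mul_of_nonneg_left h8 (Real.exp_pos 1).le
    linarith
  obtain ⟨hl3, hΛ⟩ := hexp hy12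
  refine ⟨4 / 3 * l, by linarith, hΛ, ?_⟩
  have hE : Real.exp 1 * m * (3 * γ + P) * l * 3 < n * ε ^ 2 := by
    have h4 := mul_lt_mul_of_pos_left h2 (show 0 < x * ε ^ 2 by positivity)
    have h5 : x * ε ^ 2 * (b₂ * l) = Real.exp 1 * m * (3 * γ + P) * l * 3 := by
      rw [hb₂, hm]
      field_simp
      ring
    have h6 : x * ε ^ 2 * y = n * ε ^ 2 := by rw [← hxy]; ring
    linarith
  have hml : 0 ≤ m * l := by positivity
  have hE1 : 24 * (γ * (m * l)) ≤ n * ε ^ 2 := by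
    have h4 : 0 ≤ γ * (m * l) := by positivity
    have h5 : 0 ≤ Real.exp 1 * m * P * l := by positivity
    have h6 := mul_le_mul_of_nonneg_right (show 24 / 9 ≤ Real.exp 1 by linarith) h4
    linarith
  have hE2 : 9 * (Real.exp 1 * (m * l)) ≤ n * ε ^ 2 := by
    have h4 : 0 ≤ Real.exp 1 * (m * l) := by positivity
    have h5 : 0 ≤ Real.exp 1 * m * P * l := by positivity
    have h6 := mul_le_mul_of_nonneg_right hγ.le h4
    linarith
  have hLl : 60 * (L * l) ≤ n * ε ^ 2 := by
    have h4 : n * ε ^ 4 ≤ n * ε ^ 2 := by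
      have : (n : ℝ) * ε ^ 4 = n * ε ^ 2 * ε ^ 2 := by ring
      rw [this]
      exact mul_le_of_le_one_right (by positivity) hε2
    have h5 : 0 ≤ L * l := by positivity
    have h6 := mul_le_mul_of_nonneg_left hl3 h5
    linarith
  have hA : 2 * x * (2 * l + 1) ≤ 5 * (γ * (m * l)) := by
    have h4 : x ≤ m * γ := by
      rw [hm, div_mul_eq_mul_div, le_div_iff₀ hγ']
      exact (mul_le_mul_of_nonneg_left (by linarith) (by positivity)).trans
        (mul_le_mul_of_nonneg_right (le_mul_of_one_le_left (by positivity) hC1) (by linarith))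
    have h5 : 2 * (2 * l + 1) ≤ 5 * l := by linarith
    have := mul_le_mul h4 h5 (by positivity) (by positivity)
    linarith
  -- The four parts of the code length take at most `5/24`, `8/27`, `1/45` and `2/3` of `nε²`,
  -- together less than `2`.
  linarith

/-- The order of the code length at a fixed failure probability. -/
theorem codeLength_le_mul_log_sq {C γ : ℝ} (hγ : 1 < γ) {n : ℕ} (hn : 2 ≤ n) {L : ℝ}
    (hL : 0 ≤ L) :
    2 * (n : ℝ) ^ (1 / γ) * (2 * Real.log n + 1) +
      (2 * Real.exp 1 * (max C 1 * (n : ℝ) ^ (1 / γ) / (γ - 1)) + L) *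
        (Real.log n + 4 / (γ - 1)) + L ≤
      (16 + (2 * Real.exp 1 * max C 1 / (γ - 1) + L) * (2 + 16 / (γ - 1)) + 4 * L) *
        ((n : ℝ) ^ (1 / γ) * Real.log n ^ 2) := by
  have hn1 : (1 : ℝ) ≤ n := by exact_mod_cast (by omega : 1 ≤ n)
  have hγ' : 0 < γ - 1 := sub_pos.mpr hγ
  have hC1 : 1 ≤ max C 1 := le_max_right _ _
  have hl2 : 0.6931471803 < Real.log n :=
    Real.log_two_gt_d9.trans_le (Real.log_le_log two_pos (by exact_mod_cast hn))
  have hx1 : 1 ≤ (n : ℝ) ^ (1 / γ) := Real.one_le_rpow hn1 (by positivity)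
  set l := Real.log n
  set x := (n : ℝ) ^ (1 / γ)
  have h1 : 1 ≤ 4 * l ^ 2 := by nlinarith
  have h2 : l ≤ 2 * l ^ 2 := by nlinarith
  have hA : 2 * x * (2 * l + 1) ≤ 16 * (x * l ^ 2) := by
    have := mul_le_mul_of_nonneg_left (show 2 * (2 * l + 1) ≤ 16 * l ^ 2 by linarith)
      (show 0 ≤ x by positivity)
    linarith
  have hB : 2 * Real.exp 1 * (max C 1 * x / (γ - 1)) + L ≤
      (2 * Real.exp 1 * max C 1 / (γ - 1) + L) * x := by
    have h3 := mul_le_mul_of_nonneg_left hx1 hL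
    have h4 : 2 * Real.exp 1 * (max C 1 * x / (γ - 1)) =
      2 * Real.exp 1 * max C 1 / (γ - 1) * x := by ring
    linarith
  have hD : l + 4 / (γ - 1) ≤ (2 + 16 / (γ - 1)) * l ^ 2 := by
    have h3 := mul_le_mul_of_nonneg_left h1 (show 0 ≤ 4 / (γ - 1) by positivity)
    have h4 : 16 / (γ - 1) = 4 * (4 / (γ - 1)) := by ring
    rw [h4]
    linarith
  have hE := mul_le_mul hB hD (by positivity) (by positivity)
  have hF : L ≤ 4 * L * (x * l ^ 2) := by
    have h3 : 1 ≤ 4 * l ^ 2 * x := by nlinarith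
    have := mul_le_mul_of_nonneg_left h3 hL
    linarith
  linarith

/-- Data lengths of order `(ε⁻² (ln 1/ε)²) ^ (γ / (γ - 1))` suffice for a bound of order
`(ln n)² / n ^ ((γ - 1) / γ)` to drop below `ε²`. -/
theorem mul_log_sq_lt_of_le {γ K₁ R ε : ℝ} (hγ : 1 < γ) (hK₁ : 1 ≤ K₁)
    (hR : R = Real.log (2 * (γ / (γ - 1)) * √K₁)) (hε0 : 0 < ε) (hε1 : ε ≤ 1 / 2) {n : ℕ}
    (hn : 0 < n)
    (h : ((4 * (γ / (γ - 1)) * √K₁ * (2 * R + 1)) ^ 2 + 1) ^ (γ / (γ - 1)) *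
      ((1 / ε ^ 2) * (Real.log (1 / ε)) ^ 2) ^ (γ / (γ - 1)) ≤ n) :
    K₁ * Real.log n ^ 2 < (n : ℝ) ^ ((γ - 1) / γ) * ε ^ 2 := by
  have hn0 : (0 : ℝ) < n := by exact_mod_cast hn
  have hlogn : 0 ≤ Real.log n := Real.log_nonneg (by exact_mod_cast hn)
  have hγ' : 0 < γ - 1 := sub_pos.mpr hγ
  have hp : 1 ≤ γ / (γ - 1) := by rw [le_div_iff₀ hγ']; linarith
  have hlogy := log_rpow_eq (γ := γ) hn
  have hy0 : 0 < (n : ℝ) ^ ((γ - 1) / γ) := Real.rpow_pos_of_pos hn0 _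
  rw [← Real.mul_rpow (by positivity) (by positivity)] at h
  have h1 := le_rpow_of_rpow_le hγ (by positivity) h
  have hpl : γ / (γ - 1) * ((γ - 1) / γ * Real.log n) = Real.log n := by
    field_simp
  rw [← hlogy] at hpl
  set p := γ / (γ - 1) with hpdef
  set y := (n : ℝ) ^ ((γ - 1) / γ) with hy
  set S := 4 * p * √K₁ * (2 * R + 1) with hS
  have hsK : 1 ≤ √K₁ := Real.one_le_sqrt.mpr hK₁
  have hΛ : 1 / 2 ≤ Real.log (1 / ε) := by
    have : Real.log 2 ≤ Real.log (1 / ε) := by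
      refine Real.log_le_log two_pos ?_
      rw [le_div_iff₀ hε0]
      linarith
    linarith [Real.log_two_gt_d9]
  have hR0 : 0 ≤ R := hR ▸ Real.log_nonneg (by nlinarith)
  have hS0 : 0 < S := by positivity
  set Λ := Real.log (1 / ε) with hΛdef
  -- Chosen so that `c ln √y = √K₁ ln n / ε`; the claim is the square of `c ln √y < √y`. The factor
  -- `2R + 1` in `S` absorbs `R + Λ`, as `Λ ≥ 1/2`, and the `+ 1` in the hypothesis gives
  -- strictness.
  set c := 2 * p * √K₁ / ε with hc
  have hc0 : 0 < c := by positivity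
  have hlogc : Real.log c = R + Λ := by
    rw [hc, hR, hΛdef, ← Real.log_mul (by positivity) (by positivity), mul_one_div]
  have hlt : 2 * c * max (Real.log c) 0 < √y := by
    rw [max_eq_left (by rw [hlogc]; linarith), hlogc]
    refine lt_of_le_of_lt (b := S * Λ / ε) ?_ (Real.lt_sqrt_of_sq_lt (lt_of_lt_of_le ?_ h1))
    · have h2 : R + Λ ≤ (2 * R + 1) * Λ := by nlinarith
      calc 2 * c * (R + Λ) ≤ 2 * c * ((2 * R + 1) * Λ) := by gcongr
        _ = S * Λ / ε := by
          rw [hc, hS]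
          ring
    · have h2 : 0 < 1 / ε ^ 2 * Λ ^ 2 := by positivity
      have h3 : (S * Λ / ε) ^ 2 = S ^ 2 * (1 / ε ^ 2 * Λ ^ 2) := by ring
      rw [h3]
      exact mul_lt_mul_of_pos_right (by linarith) h2
  have h4 := mul_log_lt_of_two_mul_log_lt hc0 (Real.sqrt_pos.mpr hy0) hlt
  rw [Real.log_sqrt hy0.le] at h4
  have h5 : c * (Real.log y / 2) = √K₁ * Real.log n / ε := by
    rw [← hpl, hc]
    ring
  rw [h5, div_lt_iff₀ hε0] at h4
  have h6 := pow_lt_pow_left₀ h4 (by positivity) two_ne_zero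
  rwa [mul_pow, mul_pow, Real.sq_sqrt (by linarith), Real.sq_sqrt hy0.le] at h6

end Estimates

/-! ### Assembling the explicit statements -/

section Main

variable {Z H : Type*} [MeasurableSpace Z] [DiscreteMeasurableSpace Z]
  {ℓ : H → Z → ℝ} {A : List Z → H} {Q : Measure Z} [IsProbabilityMeasure Q] {C γ : ℝ}

/-- The claim is empty if the `δᵢ` sum to at least `1`, and deterministic if the square root is at
least `1`. Otherwise `codeLength_le_explicit` applies; here `B > 2` excludes `n = 1`. -/
theorem one_sub_le_measure_genGap_le_explicit (hC : 0 < C) (hγ : 1 < γ) (hA : IsSymmetricAlg A)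
    (hQ : PowerLawDecay Q C γ) {n : ℕ} {δ₁ δ₂ δ₃ : ℝ} (hn : 0 < n) (h₁ : 0 < δ₁) (h₂ : 0 < δ₂)
    (h₃ : 0 < δ₃) :
    1 - (δ₁ + δ₂ + δ₃) ≤ (Measure.pi fun _ : Fin n => Q).real
      {zs | (genGap ℓ Q zs (A (List.ofFn zs)) : EReal) ≤
        lossDiam ℓ *
          (√(((powerLawKappaBound C γ n + √((n : ℝ) / 2 * Real.log (2 / δ₃))) *
                (3 * Real.log n + Real.log (2 * Real.pi) + Real.log (1 / δ₂))
              + Real.log (1 / δ₁)) / (2 * n)) : ℝ)} := by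
  rcases le_or_gt 1 (δ₁ + δ₂ + δ₃) with hδ | hδ
  · exact le_trans (by linarith) measureReal_nonneg
  have hn0 : (0 : ℝ) < n := by exact_mod_cast hn
  have hn1 : (1 : ℝ) ≤ n := by exact_mod_cast hn
  have hγ' : 0 < γ - 1 := sub_pos.mpr hγ
  have hlogn : 0 ≤ Real.log n := Real.log_nonneg hn1
  have hlog : ∀ {d : ℝ}, 0 < d → d < 1 → 0 < Real.log (1 / d) := fun h0 h1 =>
    Real.log_pos (by rwa [lt_div_iff₀ h0, one_mul])
  have hD := hlog h₁ (by linarith)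
  have hD₂ := hlog h₂ (by linarith)
  have hL := hlog h₃ (by linarith)
  have hLL : Real.log (1 / δ₃) ≤ Real.log (2 / δ₃) := by
    refine Real.log_le_log (by positivity) ?_
    gcongr
    norm_num
  set s := √((n : ℝ) / 2 * Real.log (2 / δ₃)) with hs
  have hs0 : 0 ≤ s := Real.sqrt_nonneg _
  set M := 3 * Real.log n + Real.log (2 * Real.pi) + Real.log (1 / δ₂) with hMdef
  have hM : 3 * Real.log n + 1 ≤ M := by linarith [one_le_log_two_pi]
  have hk : Real.exp 1 ≤ powerLawKappaBound C γ n := by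
    have h1 : 1 ≤ (Real.log n + γ) / (γ - 1) := by
      rw [le_div_iff₀ hγ']
      linarith
    calc Real.exp 1 = Real.exp 1 * (1 * 1 * 1) := by ring
      _ ≤ Real.exp 1 * (max C 1 * (n : ℝ) ^ (1 / γ) * ((Real.log n + γ) / (γ - 1))) := by
        gcongr
        · exact le_max_right _ _
        · exact Real.one_le_rpow hn1 (by positivity)
      _ = _ := by
        rw [powerLawKappaBound]
        ring
  have hkM : Real.exp 1 ≤ (powerLawKappaBound C γ n + s) * M := by
    have := mul_le_mul (hk.trans (le_add_of_nonneg_right hs0)) (show 1 ≤ M by linarith)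
      zero_le_one ((Real.exp_pos 1).le.trans (hk.trans (le_add_of_nonneg_right hs0)))
    linarith
  set B := (powerLawKappaBound C γ n + s) * M + Real.log (1 / δ₁) with hB
  have hB2 : 2 < B := by linarith [Real.exp_one_gt_d9]
  rcases le_or_gt (2 * (n : ℝ)) B with htriv | hlt
  · obtain ⟨e, -⟩ := hQ
    have : Nonempty Z := ⟨e 0⟩
    rw [measure_genGap_le_eq_one ℓ A Q hn
      (Real.one_le_sqrt.mpr (by rwa [le_div_iff₀ (by positivity), one_mul]))]
    linarith
  · have hn2 : 2 ≤ n := by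
      by_contra hcon
      have : n = 1 := by omega
      rw [this] at hlt
      norm_num at hlt
      linarith
    obtain ⟨Λ, hΛ, hΛ', hcost⟩ := codeLength_le_explicit hγ hn2 hM hL.le hLL hs hD.le hlt
    have key := le_measure_genGap_le (ℓ := ℓ) hA hC hγ hQ hn2 hΛ hΛ' h₁
      (L := Real.log (1 / δ₃)) (t := √(B / (2 * n))) (Real.sqrt_pos.mpr (by positivity)) (by
        rw [Real.sq_sqrt (by positivity), mul_div_cancel₀ _ (by positivity)]
        exact hcost)
    refine le_trans ?_ key
    rw [← Real.log_inv, one_div, inv_inv, Real.exp_log h₃]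
    linarith

theorem one_sub_le_measure_genGap_lt_of_length (hC : 0 < C) (hγ : 1 < γ) (hA : IsSymmetricAlg A)
    (hQ : PowerLawDecay Q C γ) {n : ℕ} {δ ε : ℝ} (hdiam : 0 < lossDiam ℓ)
    (hδ : δ ∈ Set.Ioc (0 : ℝ) 1) (hε : ε ∈ Set.Ioc (0 : ℝ) 1) (hω : omega δ ε < n)
    (hlen : powerLawLength C γ δ ε < n) :
    1 - δ ≤ (Measure.pi fun _ : Fin n => Q).real
      {zs | (genGap ℓ Q zs (A (List.ofFn zs)) : EReal) < lossDiam ℓ * (ε : ℝ)} := by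
  obtain ⟨hn, Λ, hΛ, hΛ', hcost⟩ := codeLength_lt_of_lt hγ hδ hε hω hlen
  have hδ3 : 0 < δ / 3 := div_pos hδ.1 three_pos
  refine le_trans ?_ (le_measure_genGap_lt (δ := δ / 3) hA hC hγ hQ hn hΛ hΛ' hδ3 hε.1 hdiam
    (by rwa [one_div_div]))
  rw [← Real.log_inv, inv_div, Real.exp_log hδ3]
  linarith [hδ.1]

end Main

end GenGap

theorem mainTheorem8 (C γ : ℝ) (hC : 0 < C) (hγ : 1 < γ) :
    -- explicit bounds
    (∀ (Z : Type*) [MeasurableSpace Z] [DiscreteMeasurableSpace Z] (H : Type*)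
        (ℓ : H → Z → ℝ) (A : List Z → H) (Q : Measure Z) [IsProbabilityMeasure Q],
        GenGap.IsSymmetricAlg A → GenGap.PowerLawDecay Q C γ →
      (∀ n : ℕ, 0 < n →
        GenGap.kappaStar Q n ≤ ENNReal.ofReal (GenGap.powerLawKappaBound C γ n)) ∧
      (∀ (n : ℕ) (δ₁ δ₂ δ₃ : ℝ), 0 < n → 0 < δ₁ → 0 < δ₂ → 0 < δ₃ →
        1 - (δ₁ + δ₂ + δ₃) ≤ (Measure.pi fun _ : Fin n => Q).real
          {zs | (GenGap.genGap ℓ Q zs (A (List.ofFn zs)) : EReal) ≤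
            GenGap.lossDiam ℓ *
              (√(((GenGap.powerLawKappaBound C γ n + √((n : ℝ) / 2 * Real.log (2 / δ₃))) *
                    (3 * Real.log n + Real.log (2 * Real.pi) + Real.log (1 / δ₂))
                  + Real.log (1 / δ₁)) / (2 * n)) : ℝ)}) ∧
      (∀ (n : ℕ) (δ ε : ℝ), 0 < GenGap.lossDiam ℓ →
        δ ∈ Set.Ioc (0 : ℝ) 1 → ε ∈ Set.Ioc (0 : ℝ) 1 →
        GenGap.omega δ ε < n → GenGap.powerLawLength C γ δ ε < n →
        1 - δ ≤ (Measure.pi fun _ : Fin n => Q).real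
          {zs | (GenGap.genGap ℓ Q zs (A (List.ofFn zs)) : EReal) <
            GenGap.lossDiam ℓ * (ε : ℝ)})) ∧
    -- rate of the gap and order of the sufficient data length, with a constant that depends only
    -- on `C`, `γ` and the failure probability
    (∀ δ ∈ Set.Ioo (0 : ℝ) 1, ∃ K : ℝ, 0 < K ∧
      ∀ (Z : Type*) [MeasurableSpace Z] [DiscreteMeasurableSpace Z] (H : Type*)
        (ℓ : H → Z → ℝ) (A : List Z → H) (Q : Measure Z) [IsProbabilityMeasure Q],
        GenGap.IsSymmetricAlg A → GenGap.PowerLawDecay Q C γ →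
      (∀ n : ℕ, 2 ≤ n →
        1 - δ ≤ (Measure.pi fun _ : Fin n => Q).real
          {zs | (GenGap.genGap ℓ Q zs (A (List.ofFn zs)) : EReal) ≤
            GenGap.lossDiam ℓ *
              (K * √((Real.log n) ^ 2 / (n : ℝ) ^ ((γ - 1) / γ)) : ℝ)}) ∧
      (∀ (n : ℕ) (ε : ℝ), 0 < GenGap.lossDiam ℓ → ε ∈ Set.Ioc (0 : ℝ) (1 / 2) →
        K * ((1 / ε ^ 2) * (Real.log (1 / ε)) ^ 2) ^ (γ / (γ - 1)) ≤ n →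
        1 - δ ≤ (Measure.pi fun _ : Fin n => Q).real
          {zs | (GenGap.genGap ℓ Q zs (A (List.ofFn zs)) : EReal) <
            GenGap.lossDiam ℓ * (ε : ℝ)})) := by
  refine ⟨?_, ?_⟩
  · intro Z _ _ H ℓ A Q _ hA hQ
    exact ⟨fun n hn => GenGap.kappaStar_le Q hC hγ hQ hn,
      fun n δ₁ δ₂ δ₃ hn h₁ h₂ h₃ =>
        GenGap.one_sub_le_measure_genGap_le_explicit hC hγ hA hQ hn h₁ h₂ h₃,
      fun n δ ε hdiam hδ hε hω hlen =>
        GenGap.one_sub_le_measure_genGap_lt_of_length hC hγ hA hQ hdiam hδ hε hω hlen⟩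
  · rintro δ ⟨hδ0, hδ1⟩
    have hγ' : 0 < γ - 1 := sub_pos.mpr hγ
    have hδ2 : 0 < δ / 2 := half_pos hδ0
    have hL : 0 ≤ Real.log (2 / δ) := Real.log_nonneg (by rw [le_div_iff₀ hδ0]; linarith)
    have hexp : 1 - δ ≤ 1 - (δ / 2 + Real.exp (-Real.log (2 / δ))) := by
      rw [← Real.log_inv, inv_div, Real.exp_log hδ2]
      linarith
    have hΛ : ∀ n : ℕ, 4 / (γ - 1) ≤ Real.log n + 4 / (γ - 1) := fun n => by
      linarith [Real.log_natCast_nonneg n]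
    set L := Real.log (2 / δ) with hLdef
    -- `K₁` is the coefficient of the code length for `Λ = ln n + 4/(γ-1)`, and `K₂` the length at
    -- which `K₁ (ln n)² < n^((γ-1)/γ) ε²`. The failure probability is split as `δ/2 + δ/2`.
    set K₁ := 16 + (2 * Real.exp 1 * max C 1 / (γ - 1) + L) * (2 + 16 / (γ - 1)) + 4 * L with hK₁
    have hC1 : 0 < max C 1 := lt_max_of_lt_right one_pos
    have h16 : 16 ≤ K₁ := by
      have : 0 ≤ (2 * Real.exp 1 * max C 1 / (γ - 1) + L) * (2 + 16 / (γ - 1)) := by positivity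
      linarith
    set R := Real.log (2 * (γ / (γ - 1)) * √K₁) with hR
    set K₂ := ((4 * (γ / (γ - 1)) * √K₁ * (2 * R + 1)) ^ 2 + 1) ^ (γ / (γ - 1)) with hK₂
    refine ⟨max K₁ K₂, by linarith [le_max_left K₁ K₂], ?_⟩
    intro Z _ _ H ℓ A Q _ hA hQ
    refine ⟨fun n hn => ?_, fun n ε hdiam hε hn => ?_⟩
    · have hn0 : (0 : ℝ) < n := by positivity
      have hlogn : 0 < Real.log n := Real.log_pos (by exact_mod_cast (by omega : 1 < n))
      have hy0 : 0 < (n : ℝ) ^ ((γ - 1) / γ) := Real.rpow_pos_of_pos hn0 _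
      have hK0 : 0 < max K₁ K₂ := by linarith [le_max_left K₁ K₂]
      refine hexp.trans (GenGap.le_measure_genGap_le hA hC hγ hQ hn
        (le_add_of_nonneg_right (by positivity)) (hΛ n) hδ2 (by positivity) ?_)
      rw [one_div_div]
      refine (GenGap.codeLength_le_mul_log_sq hγ hn hL).trans ?_
      rw [mul_pow, Real.sq_sqrt (by positivity)]
      have hxy := GenGap.rpow_mul_rpow_eq_self hγ (by omega : 0 < n)
      have heq : 2 * (n : ℝ) * (max K₁ K₂ ^ 2 * (Real.log n ^ 2 / (n : ℝ) ^ ((γ - 1) / γ))) =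
          2 * max K₁ K₂ ^ 2 * ((n : ℝ) ^ (1 / γ) * Real.log n ^ 2) := by
        nth_rw 1 [← hxy]
        field_simp
      rw [heq, ← hK₁]
      refine mul_le_mul_of_nonneg_right ?_ (by positivity)
      -- `K₁ ≤ 2K²` because `K ≥ K₁ ≥ 16`.
      nlinarith [le_max_left K₁ K₂]
    · obtain ⟨hε0, hε1⟩ := hε
      have hp : 0 < γ / (γ - 1) := div_pos (by linarith) hγ'
      have hbase : 1 ≤ (1 / ε ^ 2) * (Real.log (1 / ε)) ^ 2 := by
        have h1 : 2 ≤ 1 / ε := by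
          rw [le_div_iff₀ hε0]
          linarith
        have h2 : 1 / 2 ≤ Real.log (1 / ε) := by
          linarith [Real.log_two_gt_d9, Real.log_le_log two_pos h1]
        have h3 : 1 ≤ 1 / ε * Real.log (1 / ε) := by nlinarith
        have h4 : (1 / ε ^ 2) * (Real.log (1 / ε)) ^ 2 = (1 / ε * Real.log (1 / ε)) ^ 2 := by ring
        rw [h4]
        exact one_le_pow₀ h3
      have hbp := Real.one_le_rpow hbase hp.le
      have hK0 : 0 < max K₁ K₂ := by linarith [le_max_left K₁ K₂]
      have hn2 : 2 ≤ n := by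
        have h1 := (le_mul_of_one_le_right hK0.le hbp).trans hn
        have h2 : (2 : ℝ) ≤ n := by linarith [le_max_left K₁ K₂]
        exact_mod_cast h2
      have hn0 : (0 : ℝ) < n := by positivity
      have hlt := GenGap.mul_log_sq_lt_of_le hγ (by linarith) hR hε0 hε1 (by omega : 0 < n)
        ((mul_le_mul_of_nonneg_right (le_max_right K₁ K₂) (zero_le_one.trans hbp)).trans hn)
      refine hexp.trans (GenGap.le_measure_genGap_lt hA hC hγ hQ hn2
        (le_add_of_nonneg_right (by positivity)) (hΛ n) hδ2 hε0 hdiam ?_)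
      rw [one_div_div]
      refine (GenGap.codeLength_le_mul_log_sq hγ hn2 hL).trans_lt ?_
      have hx0 : 0 < (n : ℝ) ^ (1 / γ) := Real.rpow_pos_of_pos hn0 _
      have hxy := GenGap.rpow_mul_rpow_eq_self hγ (by omega : 0 < n)
      have h1 := mul_lt_mul_of_pos_left hlt hx0
      rw [← mul_assoc _ _ (ε ^ 2), hxy] at h1
      rw [← hK₁]
      have h2 : 0 < (n : ℝ) * ε ^ 2 := by positivity
      linarith
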